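/- **Setting.** Let $K\in\mathbb N=\{1,2,\dots\}$ and let $X_k=\{X_k(n):n\in\mathbb N\}$, $k\in[K]=\{1,\dots,K\}$, be independent data streams. For each $k$ let $\mathrm P_k^0,\mathrm P_k^1$ be two probability laws for $X_k$; stream $k$ is *noise* if its law is $\mathrm P_k^0$ and a *signal* if its law is $\mathrm P_k^1$. For $A\subseteq[K]$ let $\mathrm P_A$ be the product law under which exactly the streams in $A$ are signals, and $\mathrm E_A$ the expectation under $\mathrm P_A$. Put $\mathcal F_k(n)=\sigma(X_k(1),\dots,X_k(n))$ and $\mathcal F(n)=\sigma(\mathcal F_1(n),\dots,\mathcal F_K(n))$. **Procedures.** A sequential multiple testing procedure $\chi=(T_k,D_k)_{k\in[K]}$ consists of random times $T_k\in\mathbb N\cup\{\infty\}$ and $\{0,1\}$-valued random variables $D_k$ ($D_k=1$ means that stream $k$ is declared a signal) such that $\{T_k=n\},\{T_k=n,D_k=i\}\in\mathcal F(n)$ for all $k\in[K]$, $n\in\mathbb N$, $i\in\{0,1\}$. It is *decentralized* if these events belong to $\mathcal F_k(n)$. For integers $0\le l\le u\le K$ with $u>0$ and $l<K$, let $\Pi_{l,u}=\{A\subseteq[K]:l\le|A|\le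 u\}$. For $\alpha,\beta\in(0,1)$ let $\Delta(\alpha,\beta)$ be the set of procedures such that, for every $A\in\Pi_{l,u}$, $\mathrm P_A(T_k<\infty)=1$ for all $k\in[K]$, $\mathrm P_A(\exists j\notin A: D_j=1)\le\alpha$ and $\mathrm P_A(\exists i\in A: D_i=0)\le\beta$. Let $\mathcal L_{k,A}(\alpha,\beta)$ (resp. $\mathcal L'_{k,A}(\alpha,\beta)$) be the infimum of $\mathrm E_A[T_k]$ over all (resp. all decentralized) procedures in $\Delta(\alpha,\beta)$. The asymptotic relative efficiency of decentralized procedures versus the general family is $$\operatorname{ARE}'_{k,A}(l,u)=\lim_{\alpha,\beta\to0}\frac{\mathcal L_{k,A}(\alpha,\beta)}{\mathcal L'_{k,A}(\alpha,\beta)},$$ where $\alpha$ and $\beta$ tend to $0$ from above, jointly and without any relation between them. **Assumptions.** For every $k\in[K]$ and $n\in\mathbb N$, $\mathrm P_k^1$ and $\mathrm P_k^0$ are mutually absolutely continuous on $\mathcal F_k(n)$; let $\lambda_k(n)=\log\frac{d\mathrm P_k^1}{d\mathrm P_k^0}(\mathcal F_k(n))$. For every $k\in[K]$ there are numbers $I_k,J_k>0$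 with $$\mathrm P_k^1\Big(\limsup_{n\to\infty}\tfrac{\lambda_k(n)}n\le I_k\Big)=1,\qquad \mathrm P_k^0\Big(\limsup_{n\to\infty}\tfrac{-\lambda_k(n)}n\le J_k\Big)=1,$$ and, for every $\epsilon>0$, $$\sum_{n=1}^\infty\mathrm P_k^1\Big(\tfrac{\lambda_k(n)}n\le I_k-\epsilon\Big)<\infty,\qquad \sum_{n=1}^\infty\mathrm P_k^0\Big(\tfrac{-\lambda_k(n)}n\le J_k-\epsilon\Big)<\infty.$$ **Claim.** Let $A\in\Pi_{l,u}$, and put $\mathcal I_A=\min_{i\in A}I_i$ and $\mathcal J_A=\min_{j\notin A}J_j$. Then, for every $i\in A$ and every $j\notin A$, the limits defining $\operatorname{ARE}'_{i,A}(l,u)$ and $\operatorname{ARE}'_{j,A}(l,u)$ exist and $$\operatorname{ARE}'_{i,A}(l,u)=\begin{cases}\dfrac{I_i}{I_i+\mathcal J_A}&\text{if }|A|=l,\\[1ex]1&\text{otherwise,}\end{cases}\qquad \operatorname{ARE}'_{j,A}(l,u)=\begin{cases}\dfrac{J_j}{J_j+\mathcal I_A}&\text{if }|A|=u,\\[1ex]1&\text{otherwise.}\end{cases}$$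 In particular, if $l=0$ then $\operatorname{ARE}'_{i,A}(l,u)=1$ for all $i\in A$, and if $u=K$ then $\operatorname{ARE}'_{j,A}(l,u)=1$ for all $j\notin A$. -/

import Mathlib

open MeasureTheory Filter Topology
open scoped ENNReal

namespace SeqTest

noncomputable section

/-- The `σ`-algebra generated by the first `n` observations of one stream.  A path is a sequence
`x : ℕ → S`, where `x t` is the observation made at time `t + 1`. -/
abbrev pathSigma (S : Type*) [MeasurableSpace S] (n : ℕ) : MeasurableSpace (ℕ → S) :=
  cylinderEvents (Set.Iio n)

/-- The restriction of the law `P` of one stream to its first `n` observations. -/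
def restr {S : Type*} [MeasurableSpace S] (P : Measure (ℕ → S)) (n : ℕ) :
    @Measure (ℕ → S) (pathSigma S n) :=
  P.trim cylinderEvents_le_pi

/-- The log-likelihood ratio of `P₁` versus `P₀` based on the first `n` observations. -/
def logLR {S : Type*} [MeasurableSpace S] (P₀ P₁ : Measure (ℕ → S)) (n : ℕ) (x : ℕ → S) : ℝ :=
  llr (restr P₁ n) (restr P₀ n) x

/-- The distributional assumptions on one stream, with law `P₀` under the null and `P₁` under the
alternative hypothesis, and with rates `I` (under `P₁`) and `J` (under `P₀`). -/
structure StreamAssumptions {S : Type*} [MeasurableSpace S] (P₀ P₁ : Measure (ℕ → S))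
    (I J : ℝ) : Prop where
  I_pos : 0 < I
  J_pos : 0 < J
  /-- The two laws are mutually absolutely continuous on every finite horizon. -/
  ac₁ : ∀ n, restr P₁ n ≪ restr P₀ n
  ac₀ : ∀ n, restr P₀ n ≪ restr P₁ n
  /-- Almost sure upper bounds on the growth of the log-likelihood ratio. -/
  limsup₁ : ∀ᵐ x ∂P₁, limsup (fun n : ℕ => ((logLR P₀ P₁ n x / n : ℝ) : EReal)) atTop ≤ (I : EReal)
  limsup₀ : ∀ᵐ x ∂P₀, limsup (fun n : ℕ => ((-logLR P₀ P₁ n x / n : ℝ) : EReal)) atTop ≤ (J : EReal)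
  /-- One-sided complete convergence; the sums run over the times `n + 1 ≥ 1`. -/
  complete₁ : ∀ ε : ℝ, 0 < ε →
    ∑' n : ℕ, P₁ {x | logLR P₀ P₁ (n + 1) x / (n + 1 : ℕ) ≤ I - ε} < ∞
  complete₀ : ∀ ε : ℝ, 0 < ε →
    ∑' n : ℕ, P₀ {x | -logLR P₀ P₁ (n + 1) x / (n + 1 : ℕ) ≤ J - ε} < ∞

variable {K : ℕ} {S : Fin K → Type*} [∀ k, MeasurableSpace (S k)]

/-- The information of stream `k` alone up to time `n`, on the joint path space. -/
abbrev localSigma (S : Fin K → Type*) [∀ k, MeasurableSpace (S k)] (k : Fin K) (n : ℕ) :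
    MeasurableSpace (∀ k, ℕ → S k) :=
  (pathSigma (S k) n).comap (fun ω => ω k)

/-- The information of all streams up to time `n`. -/
abbrev globalSigma (S : Fin K → Type*) [∀ k, MeasurableSpace (S k)] (n : ℕ) :
    MeasurableSpace (∀ k, ℕ → S k) :=
  ⨆ k, localSigma S k n

/-- The joint law when `A` is the set of signals: the streams are independent, those in `A`
follow `P₁`, the others follow `P₀`. -/
def jointLaw (P₀ P₁ : ∀ k, Measure (ℕ → S k)) (A : Finset (Fin K)) : Measure (∀ k, ℕ → S k) :=
  Measure.pi (fun k => if k ∈ A then P₁ k else P₀ k)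

/-- `T` is a stopping time with values in `{1, 2, …} ∪ {∞}` with respect to `F`, and `D` is a
binary random variable that is determined by the information available at time `T`. -/
structure IsDecision {Ω : Type*} [MeasurableSpace Ω] (F : ℕ → MeasurableSpace Ω)
    (T : Ω → ℕ∞) (D : Ω → Bool) : Prop where
  one_le : ∀ ω, 1 ≤ T ω
  measurable_D : Measurable D
  time : ∀ n : ℕ, MeasurableSet[F n] {ω | T ω = n}
  decision : ∀ (n : ℕ) (i : Bool), MeasurableSet[F n] {ω | T ω = n ∧ D ω = i}

/-- A sequential multiple testing procedure: decision times `T k` and decisions `D k`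
(`true` means that stream `k` is identified as a signal), based on the data of all streams. -/
structure Procedure (S : Fin K → Type*) [∀ k, MeasurableSpace (S k)] where
  T : Fin K → (∀ k, ℕ → S k) → ℕ∞
  D : Fin K → (∀ k, ℕ → S k) → Bool
  isDecision : ∀ k, IsDecision (globalSigma S) (T k) (D k)

/-- In a decentralized procedure, each decision uses only the data of its own stream. -/
def Procedure.Decentralized (χ : Procedure S) : Prop :=
  ∀ k, IsDecision (localSigma S k) (χ.T k) (χ.D k)

/-- Type-I familywise error rate when `A` is the set of signals. -/
def Procedure.fwe₁ (χ : Procedure S) (P₀ P₁ : ∀ k, Measure (ℕ → S k)) (A : Finset (Fin K)) :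
    ℝ≥0∞ :=
  jointLaw P₀ P₁ A {ω | ∃ j, j ∉ A ∧ χ.D j ω = true}

/-- Type-II familywise error rate when `A` is the set of signals. -/
def Procedure.fwe₂ (χ : Procedure S) (P₀ P₁ : ∀ k, Measure (ℕ → S k)) (A : Finset (Fin K)) :
    ℝ≥0∞ :=
  jointLaw P₀ P₁ A {ω | ∃ i, i ∈ A ∧ χ.D i ω = false}

/-- The sets of signals with at least `l` and at most `u` elements. -/
def boundedClass (K l u : ℕ) : Set (Finset (Fin K)) := {A | l ≤ A.card ∧ A.card ≤ u}

/-- The procedures that, for every set of signals in `Pr`, terminate almost surely in every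
stream and have familywise error rates at most `α` and `β`. -/
def controlled (P₀ P₁ : ∀ k, Measure (ℕ → S k)) (Pr : Set (Finset (Fin K))) (α β : ℝ) :
    Set (Procedure S) :=
  {χ | ∀ A ∈ Pr, (∀ k, ∀ᵐ ω ∂(jointLaw P₀ P₁ A), χ.T k ω < ⊤) ∧
    χ.fwe₁ P₀ P₁ A ≤ ENNReal.ofReal α ∧ χ.fwe₂ P₀ P₁ A ≤ ENNReal.ofReal β}

/-- The expected decision time in stream `k` when `A` is the set of signals. -/
def Procedure.expTime (χ : Procedure S) (P₀ P₁ : ∀ k, Measure (ℕ → S k)) (k : Fin K)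
    (A : Finset (Fin K)) : ℝ≥0∞ :=
  ∫⁻ ω, (χ.T k ω : ℝ≥0∞) ∂(jointLaw P₀ P₁ A)

/-- The optimal expected decision time in stream `k` among all procedures. -/
def optTime (P₀ P₁ : ∀ k, Measure (ℕ → S k)) (Pr : Set (Finset (Fin K))) (k : Fin K)
    (A : Finset (Fin K)) (α β : ℝ) : ℝ≥0∞ :=
  ⨅ χ ∈ controlled P₀ P₁ Pr α β, χ.expTime P₀ P₁ k A

/-- The optimal expected decision time in stream `k` among decentralized procedures. -/
def optTimeDec (P₀ P₁ : ∀ k, Measure (ℕ → S k)) (Pr : Set (Finset (Fin K))) (k : Fin K)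
    (A : Finset (Fin K)) (α β : ℝ) : ℝ≥0∞ :=
  ⨅ χ ∈ {χ : Procedure S | χ.Decentralized} ∩ controlled P₀ P₁ Pr α β, χ.expTime P₀ P₁ k A

/-- The asymptotic relative efficiency of decentralized procedures in stream `k`, when `A` is the
set of signals and the number of signals is known to be between `l` and `u`, exists and is `r`:
the ratio of the two optimal expected decision times tends to `r` as `α, β → 0` jointly. -/
def HasAREDec (P₀ P₁ : ∀ k, Measure (ℕ → S k)) (l u : ℕ) (k : Fin K) (A : Finset (Fin K))
    (r : ℝ≥0∞) : Prop :=
  Tendsto (fun p : ℝ × ℝ => optTime P₀ P₁ (boundedClass K l u) k A p.1 p.2 /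
      optTimeDec P₀ P₁ (boundedClass K l u) k A p.1 p.2)
    (𝓝[>] 0 ×ˢ 𝓝[>] 0) (𝓝 r)

/-- The minimum of the numbers `r k`, `k ∈ B`; it is `∞` when `B` is empty. -/
def minRate (r : Fin K → ℝ) (B : Finset (Fin K)) : ℝ≥0∞ := B.inf (fun k => ENNReal.ofReal (r k))

end

end SeqTest

/-
Let `i ∈ A`.  A procedure with small error probabilities tells `A` apart from every admissible `B`
with `i ∉ B`.  By a change of measure, it cannot stop in stream `i` before the log-likelihood ratio
of `A` versus `B` has reached about `|log α|`; if that ratio grows at rate `R`, this takes at least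
about `|log α| / R` observations.  A decentralized procedure sees only the ratio of stream `i`, of
rate `I i`.  The same rate governs all procedures when `A \ {i}` is admissible.  When `A` has the
minimal cardinality, `B` has to contain some `j ∉ A` and the rate becomes `I i + J j`.

These bounds are attained.  A process that grows at rate `R` in the sense of complete convergence
reaches a level `a` in expected time at most `a / r + O(1)` for every `r < R`, and the probability
that a log-likelihood ratio ever exceeds `a` under the wrong law is at most `exp (-a)`.  So parallel
sequential probability ratio tests are optimal at rate `I i`.  At minimal cardinality one may also
declare `i` a signal as soon as its log-likelihood ratio exceeds those of all `j ∉ A` by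
`|log α| + O(1)`: if `i` is in fact noise, some true signal lies outside `A`.

The case `j ∉ A` follows by exchanging the two hypotheses and complementing `A`.
-/

namespace SeqTest

section LogLikelihoodRatio

lemma indicator_univ_pi_prod {ι : Type*} [Fintype ι] {X : ι → Type*} (E : ∀ k, Set (X k))
    (f : ∀ k, X k → ℝ≥0∞) (ω : ∀ k, X k) :
    (Set.univ.pi E).indicator (fun ω => ∏ k, f k (ω k)) ω = ∏ k, (E k).indicator (f k) (ω k) := by
  by_cases hω : ω ∈ Set.univ.pi E
  · rw [Set.indicator_of_mem hω]
    exact Finset.prod_congr rfl fun k _ => (Set.indicator_of_mem (hω k trivial) _).symm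
  · obtain ⟨k, hk⟩ : ∃ k, ω k ∉ E k := by simpa [Set.mem_pi] using hω
    rw [Set.indicator_of_notMem hω,
      Finset.prod_eq_zero (Finset.mem_univ k) (Set.indicator_of_notMem hk _)]

lemma setLIntegral_univ_pi_prod {ι : Type*} [Fintype ι] {X : ι → Type*}
    [∀ k, MeasurableSpace (X k)] {μ : ∀ k, Measure (X k)} [∀ k, IsProbabilityMeasure (μ k)]
    {E : ∀ k, Set (X k)} (hE : ∀ k, MeasurableSet (E k)) {f : ∀ k, X k → ℝ≥0∞}
    (hf : ∀ k, Measurable (f k)) :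
    ∫⁻ ω in Set.univ.pi E, ∏ k, f k (ω k) ∂Measure.pi μ = ∏ k, ∫⁻ x in E k, f k x ∂μ k := by
  have hm : ∀ k, Measurable ((E k).indicator (f k)) := fun k => (hf k).indicator (hE k)
  rw [← lintegral_indicator (MeasurableSet.univ_pi hE)]
  simp only [indicator_univ_pi_prod, ← lintegral_indicator (hE _)]
  rw [ProbabilityTheory.lintegral_prod_eq_prod_lintegral_of_indepFun Finset.univ _
    (ProbabilityTheory.iIndepFun_pi fun k => (hm k).aemeasurable)
    fun k => (hm k).comp (measurable_pi_apply k)]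
  exact Finset.prod_congr rfl fun k _ => (measurePreserving_eval μ k).lintegral_comp (hm k)

variable {Ω : Type*} {mΩ : MeasurableSpace Ω}

lemma measurableSet_disjointed {𝓕 : Filtration ℕ mΩ} {E : ℕ → Set Ω}
    (hE : ∀ n, MeasurableSet[𝓕 n] (E n)) (n : ℕ) : MeasurableSet[𝓕 n] (disjointed E n) := by
  rw [disjointed_eq_inter_compl]
  exact (hE n).inter (MeasurableSet.biInter (Set.to_countable {j | j < n})
    fun m hm => (𝓕.mono (le_of_lt hm) _ (hE m)).compl)

/-- `Λ` is the log-likelihood ratio process of `P` versus `Q` along the filtration `𝓕`: on `𝓕 n`,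
the law `P` has density `exp (Λ n)` with respect to `Q`. -/
structure IsLogLR (𝓕 : Filtration ℕ mΩ) (P Q : Measure Ω) (Λ : ℕ → Ω → ℝ) : Prop where
  measurable (n : ℕ) : Measurable[𝓕 n] (Λ n)
  trim_eq (n : ℕ) : P.trim (𝓕.le n) =
    (Q.trim (𝓕.le n)).withDensity fun ω => ENNReal.ofReal (Real.exp (Λ n ω))

namespace IsLogLR

variable {𝓕 : Filtration ℕ mΩ} {P Q : Measure Ω} {Λ : ℕ → Ω → ℝ}

lemma measurable_density (h : IsLogLR 𝓕 P Q Λ) (n : ℕ) :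
    Measurable[𝓕 n] fun ω => ENNReal.ofReal (Real.exp (Λ n ω)) :=
  (h.measurable n).exp.ennreal_ofReal

lemma measure_eq_setLIntegral (h : IsLogLR 𝓕 P Q Λ) {n : ℕ} {E : Set Ω}
    (hE : MeasurableSet[𝓕 n] E) :
    P E = ∫⁻ ω in E, ENNReal.ofReal (Real.exp (Λ n ω)) ∂Q := by
  rw [← trim_measurableSet_eq (𝓕.le n) hE, h.trim_eq, withDensity_apply _ hE,
    setLIntegral_trim (𝓕.le n) (h.measurable_density n) hE]

lemma of_measure_eq_setLIntegral (hΛ : ∀ n, Measurable[𝓕 n] (Λ n))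
    (h : ∀ n E, MeasurableSet[𝓕 n] E →
      P E = ∫⁻ ω in E, ENNReal.ofReal (Real.exp (Λ n ω)) ∂Q) : IsLogLR 𝓕 P Q Λ where
  measurable := hΛ
  trim_eq n := by
    refine @Measure.ext _ (𝓕 n) _ _ fun E hE => ?_
    rw [trim_measurableSet_eq _ hE, h n E hE, withDensity_apply _ hE,
      setLIntegral_trim (𝓕.le n) (hΛ n).exp.ennreal_ofReal hE]

lemma refl (𝓕 : Filtration ℕ mΩ) (P : Measure Ω) : IsLogLR 𝓕 P P 0 where
  measurable _ := measurable_const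
  trim_eq _ := by
    simp only [Pi.zero_apply, Real.exp_zero, ENNReal.ofReal_one]
    exact (@withDensity_one _ (𝓕 _) _).symm

lemma symm (h : IsLogLR 𝓕 P Q Λ) : IsLogLR 𝓕 Q P (-Λ) where
  measurable n := (h.measurable n).neg
  trim_eq n := by
    have hinv : (fun ω => ENNReal.ofReal (Real.exp ((-Λ) n ω))) =
        fun ω => (ENNReal.ofReal (Real.exp (Λ n ω)))⁻¹ := by
      simp only [Pi.neg_apply, Real.exp_neg, ENNReal.ofReal_inv_of_pos (Real.exp_pos _)]
    rw [h.trim_eq, hinv, withDensity_inv_same (h.measurable_density n)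
      (ae_of_all _ fun ω => (ENNReal.ofReal_pos.2 (Real.exp_pos _)).ne')
      (ae_of_all _ fun ω => ENNReal.ofReal_ne_top)]

lemma comp {Ω' : Type*} {mΩ' : MeasurableSpace Ω'} {𝓖 : Filtration ℕ mΩ'} {P' Q' : Measure Ω'}
    {f : Ω' → Ω} (h : IsLogLR 𝓕 P Q Λ) (h𝓖 : ∀ n, 𝓖 n = (𝓕 n).comap f)
    (hP : MeasurePreserving f P' P) (hQ : MeasurePreserving f Q' Q) :
    IsLogLR 𝓖 P' Q' fun n ω => Λ n (f ω) := by
  refine of_measure_eq_setLIntegral (fun n => ?_) fun n E hE => ?_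
  · rw [h𝓖]
    exact (h.measurable n).comp (comap_measurable f)
  · rw [h𝓖] at hE
    obtain ⟨E, hE, rfl⟩ := hE
    rw [hP.measure_preimage (𝓕.le n _ hE).nullMeasurableSet, h.measure_eq_setLIntegral hE,
      hQ.setLIntegral_comp_preimage (𝓕.le n _ hE)
        ((h.measurable_density n).mono (𝓕.le n) le_rfl)]

lemma measure_univ_pi_eq_setLIntegral {ι : Type*} [Fintype ι] {X : ι → Type*}
    [mX : ∀ k, MeasurableSpace (X k)] {𝓕 : ∀ k, Filtration ℕ (mX k)} {P Q : ∀ k, Measure (X k)}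
    [∀ k, SigmaFinite (P k)] [∀ k, IsProbabilityMeasure (Q k)] {Λ : ∀ k, ℕ → X k → ℝ}
    (h : ∀ k, IsLogLR (𝓕 k) (P k) (Q k) (Λ k)) {n : ℕ} {E : ∀ k, Set (X k)}
    (hE : ∀ k, MeasurableSet[𝓕 k n] (E k)) :
    Measure.pi P (Set.univ.pi E) =
      ∫⁻ ω in Set.univ.pi E, ENNReal.ofReal (Real.exp (∑ k, Λ k n (ω k))) ∂Measure.pi Q := by
  simp only [Real.exp_sum, ENNReal.ofReal_prod_of_nonneg fun _ _ => (Real.exp_pos _).le]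
  rw [setLIntegral_univ_pi_prod (fun k => (𝓕 k).le n _ (hE k))
    fun k => ((h k).measurable_density n).mono ((𝓕 k).le n) le_rfl, Measure.pi_pi]
  exact Finset.prod_congr rfl fun k _ => (h k).measure_eq_setLIntegral (hE k)

lemma pi {ι : Type*} [Fintype ι] {X : ι → Type*} [mX : ∀ k, MeasurableSpace (X k)]
    {𝓖 : Filtration ℕ MeasurableSpace.pi} {𝓕 : ∀ k, Filtration ℕ (mX k)}
    {P Q : ∀ k, Measure (X k)} [∀ k, IsProbabilityMeasure (P k)]
    [∀ k, IsProbabilityMeasure (Q k)] {Λ : ∀ k, ℕ → X k → ℝ}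
    (h : ∀ k, IsLogLR (𝓕 k) (P k) (Q k) (Λ k))
    (h𝓖 : ∀ n, 𝓖 n = ⨆ k, (𝓕 k n).comap fun ω : ∀ k, X k => ω k) :
    IsLogLR 𝓖 (Measure.pi P) (Measure.pi Q) fun n ω => ∑ k, Λ k n (ω k) := by
  have hbox : ∀ n, ∀ s ∈ Set.univ.pi '' Set.univ.pi (fun k => {s | MeasurableSet[𝓕 k n] s}),
      Measure.pi P s = (Measure.pi Q).withDensity
        (fun ω => ENNReal.ofReal (Real.exp (∑ k, Λ k n (ω k)))) s := by
    rintro n _ ⟨E, hE, rfl⟩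
    rw [withDensity_apply _ (MeasurableSet.univ_pi fun k => (𝓕 k).le n _ (hE k trivial))]
    exact measure_univ_pi_eq_setLIntegral h fun k => hE k trivial
  refine of_measure_eq_setLIntegral (fun n => ?_) fun n E hE => ?_
  · refine @Finset.measurable_fun_sum _ _ _ _ _ _ (𝓖 n) _ _ fun k _ => ?_
    rw [h𝓖]
    exact (((h k).measurable n).comp (comap_measurable _)).mono
      (le_iSup (fun k => (𝓕 k n).comap fun ω : ∀ k, X k => ω k) k) le_rfl
  · rw [← withDensity_apply _ (𝓖.le n _ hE)]
    exact ext_on_measurableSpace_of_generate_finite _ _ (hbox n) (𝓖.le n)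
      ((h𝓖 n).trans (@generateFrom_pi _ _ _ fun k => 𝓕 k n).symm)
      (@isPiSystem_pi _ _ fun k => 𝓕 k n)
      (hbox n _ ⟨fun _ => Set.univ, fun k _ => @MeasurableSet.univ _ (𝓕 k n), Set.pi_univ _⟩) hE

lemma measure_le_exp_mul (h : IsLogLR 𝓕 P Q Λ) {n : ℕ} {E : Set Ω} (hE : MeasurableSet[𝓕 n] E)
    {c : ℝ} (hc : ∀ ω ∈ E, Λ n ω ≤ c) : P E ≤ ENNReal.ofReal (Real.exp c) * Q E := by
  rw [h.measure_eq_setLIntegral hE, ← setLIntegral_const]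
  refine setLIntegral_mono' (𝓕.le n _ hE) fun ω hω => ?_
  gcongr
  exact hc ω hω

lemma measure_iUnion_le_exp_mul (h : IsLogLR 𝓕 P Q Λ) {E : ℕ → Set Ω}
    (hE : ∀ n, MeasurableSet[𝓕 n] (E n)) {c : ℝ} (hc : ∀ n, ∀ ω ∈ E n, Λ n ω ≤ c) :
    P (⋃ n, E n) ≤ ENNReal.ofReal (Real.exp c) * Q (⋃ n, E n) := by
  have hd : ∀ n, MeasurableSet[𝓕 n] (disjointed E n) := measurableSet_disjointed hE
  have hd' : ∀ n, MeasurableSet (disjointed E n) := fun n => 𝓕.le n _ (hd n)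
  rw [← iUnion_disjointed, measure_iUnion (disjoint_disjointed E) hd',
    measure_iUnion (disjoint_disjointed E) hd', ← ENNReal.tsum_mul_left]
  exact ENNReal.tsum_le_tsum fun n =>
    h.measure_le_exp_mul (hd n) fun ω hω => hc n ω (disjointed_subset E n hω)

lemma measure_iUnion_le_of_le [IsProbabilityMeasure P] (h : IsLogLR 𝓕 P Q Λ) (a : ℝ) :
    Q (⋃ n, {ω | a ≤ Λ n ω}) ≤ ENNReal.ofReal (Real.exp (-a)) :=
  calc Q (⋃ n, {ω | a ≤ Λ n ω})
      ≤ ENNReal.ofReal (Real.exp (-a)) * P (⋃ n, {ω | a ≤ Λ n ω}) :=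
        h.symm.measure_iUnion_le_exp_mul (fun n => h.measurable n measurableSet_Ici)
          fun _ _ hω => neg_le_neg hω
    _ ≤ ENNReal.ofReal (Real.exp (-a)) := mul_le_of_le_one_right' prob_le_one

end IsLogLR

end LogLikelihoodRatio

section Growth

variable {Ω : Type*} [MeasurableSpace Ω]

/-- Almost surely under `P`, the process `Λ` grows asymptotically at most at the linear
rate `R`. -/
def GrowthLE (P : Measure Ω) (Λ : ℕ → Ω → ℝ) (R : ℝ) : Prop :=
  ∀ᵐ ω ∂P, ∀ s > R, ∀ᶠ n : ℕ in atTop, Λ n ω ≤ s * n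

/-- Under `P`, the process `Λ` grows at least at the linear rate `R` in the sense of complete
convergence; as in `StreamAssumptions`, the sum runs over the times `n + 1 ≥ 1`. -/
def CompleteGrowthGE (P : Measure Ω) (Λ : ℕ → Ω → ℝ) (R : ℝ) : Prop :=
  ∀ r < R, ∑' n : ℕ, P {ω | Λ (n + 1) ω / (n + 1 : ℕ) ≤ r} < ∞

variable {P : Measure Ω} {Λ Λ' : ℕ → Ω → ℝ} {R R' : ℝ}

lemma GrowthLE.add (h : GrowthLE P Λ R) (h' : GrowthLE P Λ' R') :
    GrowthLE P (Λ + Λ') (R + R') := by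
  filter_upwards [h, h'] with ω hω hω' s hs
  filter_upwards [hω (R + (s - (R + R')) / 2) (by linarith),
    hω' (R' + (s - (R + R')) / 2) (by linarith)] with n hn hn'
  simp only [Pi.add_apply]
  linarith

lemma GrowthLE.comp {Ω' : Type*} [MeasurableSpace Ω'] {P' : Measure Ω'} {f : Ω' → Ω}
    (h : GrowthLE P Λ R) (hf : MeasurePreserving f P' P) :
    GrowthLE P' (fun n ω => Λ n (f ω)) R :=
  hf.quasiMeasurePreserving.ae h

lemma growthLE_of_limsup_le
    (h : ∀ᵐ ω ∂P, limsup (fun n : ℕ => ((Λ n ω / n : ℝ) : EReal)) atTop ≤ (R : EReal)) :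
    GrowthLE P Λ R := by
  filter_upwards [h] with ω hω s hs
  filter_upwards [eventually_lt_of_limsup_lt (hω.trans_lt (EReal.coe_lt_coe_iff.2 hs)),
    eventually_gt_atTop 0] with n hn hn0
  exact ((div_lt_iff₀ (Nat.cast_pos.2 hn0)).1 (EReal.coe_lt_coe_iff.1 hn)).le

lemma GrowthLE.tendsto_measure_exists_lt [IsFiniteMeasure P] (h : GrowthLE P Λ R)
    (hΛ : ∀ n, Measurable (Λ n)) {s : ℝ} (hs : 0 < s) (hRs : R < s) :
    Tendsto (fun m : ℕ => P {ω | ∃ n ≤ m, s * m < Λ n ω}) atTop (𝓝 0) := by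
  rw [← measure_empty (μ := P)]
  refine tendsto_measure_of_ae_tendsto_indicator_of_isFiniteMeasure atTop MeasurableSet.empty
    (fun m => ?_) ?_
  · have : {ω | ∃ n ≤ m, s * m < Λ n ω} = ⋃ n ∈ Set.Iic m, {ω | s * m < Λ n ω} := by
      ext; simp
    rw [this]
    exact MeasurableSet.biUnion (Set.to_countable _)
      fun n _ => measurableSet_lt measurable_const (hΛ n)
  filter_upwards [h] with ω hω
  obtain ⟨N, hN⟩ := eventually_atTop.1 (hω s hRs)
  obtain ⟨C, hC⟩ := ((Set.finite_Iio N).image fun n => Λ n ω).bddAbove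
  filter_upwards [(tendsto_natCast_atTop_atTop.const_mul_atTop hs).eventually_ge_atTop C]
    with m hm
  simp only [Set.mem_empty_iff_false, iff_false, not_exists, not_and, not_lt]
  intro n hnm
  rcases lt_or_ge n N with hnN | hNn
  · exact (hC ⟨n, hnN, rfl⟩).trans hm
  · exact (hN n hNn).trans (by gcongr)

lemma completeGrowthGE_of_forall_pos
    (h : ∀ ε : ℝ, 0 < ε → ∑' n : ℕ, P {ω | Λ (n + 1) ω / (n + 1 : ℕ) ≤ R - ε} < ∞) :
    CompleteGrowthGE P Λ R := fun r hr => by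
  simpa only [sub_sub_cancel] using h (R - r) (sub_pos.2 hr)

lemma CompleteGrowthGE.mono (h : CompleteGrowthGE P Λ R) (hR : R' ≤ R) :
    CompleteGrowthGE P Λ R' := fun r hr => h r (hr.trans_le hR)

lemma CompleteGrowthGE.add (h : CompleteGrowthGE P Λ R) (h' : CompleteGrowthGE P Λ' R') :
    CompleteGrowthGE P (Λ + Λ') (R + R') := fun r hr => by
  set δ : ℝ := (R + R' - r) / 2
  have hδ : 0 < δ := by simp only [δ]; linarith
  refine lt_of_le_of_lt ?_
    (ENNReal.add_lt_top.2 ⟨h (R - δ) (sub_lt_self R hδ), h' (R' - δ) (sub_lt_self R' hδ)⟩)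
  rw [← ENNReal.tsum_add]
  refine ENNReal.tsum_le_tsum fun n => (measure_mono fun ω hω => ?_).trans (measure_union_le _ _)
  by_contra hω'
  simp only [Set.mem_union, Set.mem_ofPred_eq, not_or, not_le, Pi.add_apply, add_div] at hω hω'
  simp only [δ] at hω'
  linarith [hω'.1, hω'.2]

lemma CompleteGrowthGE.inf' {ι : Type*} {s : Finset ι} (hs : s.Nonempty)
    {Λ : ι → ℕ → Ω → ℝ} (h : ∀ j ∈ s, CompleteGrowthGE P (Λ j) R) :
    CompleteGrowthGE P (fun n ω => s.inf' hs fun j => Λ j n ω) R := fun r hr => by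
  refine lt_of_le_of_lt ?_ (ENNReal.sum_lt_top.2 fun j hj => h j hj r hr)
  rw [← Summable.tsum_finsetSum fun _ _ => ENNReal.summable]
  refine ENNReal.tsum_le_tsum fun n =>
    (measure_mono fun ω hω => ?_).trans (measure_biUnion_finset_le _ _)
  obtain ⟨j, hj, hjeq⟩ := s.exists_mem_eq_inf' hs fun j => Λ j (n + 1) ω
  refine Set.mem_biUnion (Finset.mem_coe.2 hj) ?_
  rw [Set.mem_ofPred_eq, ← hjeq]
  exact hω

lemma CompleteGrowthGE.comp {Ω' : Type*} [MeasurableSpace Ω'] {P' : Measure Ω'} {f : Ω' → Ω}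
    (h : CompleteGrowthGE P Λ R) (hΛ : ∀ n, Measurable (Λ n)) (hf : MeasurePreserving f P' P) :
    CompleteGrowthGE P' (fun n ω => Λ n (f ω)) R := fun r hr =>
  (tsum_congr fun n => hf.measure_preimage
    (measurableSet_le ((hΛ (n + 1)).div_const _) measurable_const).nullMeasurableSet).trans_lt
    (h r hr)

end Growth

section LowerBound

variable {Ω : Type*} {mΩ : MeasurableSpace Ω} {𝓕 : Filtration ℕ mΩ} {P Q : Measure Ω}
    {Λ : ℕ → Ω → ℝ} {T : Ω → ℕ∞} {D : Ω → Bool}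

lemma IsDecision.measurable_time (h : IsDecision 𝓕 T D) : Measurable T := by
  have hn : ∀ n : ℕ, MeasurableSet {ω | T ω = n} := fun n => 𝓕.le n _ (h.time n)
  refine measurable_to_countable' fun t => ?_
  cases t with
  | coe n => exact hn n
  | top =>
    have : T ⁻¹' {⊤} = (⋃ n : ℕ, {ω | T ω = n})ᶜ := by
      ext ω
      cases hT : T ω <;> simp [hT]
    rw [this]
    exact (MeasurableSet.iUnion hn).compl

/-- An early correct detection either happens while `Λ ≤ c`, where it is at most `exp c` times as
likely as the same false detection under `Q`, or after `Λ` has exceeded `c`. -/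
lemma IsDecision.measure_time_le_le (hT : IsDecision 𝓕 T D) (h : IsLogLR 𝓕 P Q Λ) (m : ℕ)
    (c : ℝ) :
    P {ω | T ω ≤ m} ≤ P {ω | D ω = false} +
      ENNReal.ofReal (Real.exp c) * Q {ω | D ω = true} + P {ω | ∃ n ≤ m, c < Λ n ω} := by
  set E : ℕ → Set Ω := fun n => {ω | T ω = n ∧ D ω = true} ∩ {ω | Λ n ω ≤ c}
  have hcover : {ω | T ω ≤ m} ⊆
      {ω | D ω = false} ∪ (⋃ n, E n) ∪ {ω | ∃ n ≤ m, c < Λ n ω} := fun ω hω => by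
    obtain ⟨n, hn⟩ := ENat.ne_top_iff_exists.1 (ne_top_of_le_ne_top (ENat.natCast_ne_top m) hω)
    have hnm : n ≤ m := by rw [Set.mem_ofPred_eq, ← hn] at hω; exact_mod_cast hω
    rcases hD : D ω with _ | _
    · exact Or.inl (Or.inl hD)
    rcases le_or_gt (Λ n ω) c with hc | hc
    · exact Or.inl (Or.inr (Set.mem_iUnion.2 ⟨n, ⟨hn.symm, hD⟩, hc⟩))
    · exact Or.inr ⟨n, hnm, hc⟩
  have hE : P (⋃ n, E n) ≤ ENNReal.ofReal (Real.exp c) * Q {ω | D ω = true} :=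
    calc P (⋃ n, E n) ≤ ENNReal.ofReal (Real.exp c) * Q (⋃ n, E n) :=
          h.measure_iUnion_le_exp_mul
            (fun n => (hT.decision n true).inter (h.measurable n measurableSet_Iic))
            fun _ _ hω => hω.2
      _ ≤ ENNReal.ofReal (Real.exp c) * Q {ω | D ω = true} := by
          gcongr
          exact Set.iUnion_subset fun _ _ hω => hω.1.2
  calc P {ω | T ω ≤ m}
      ≤ P {ω | D ω = false} + P (⋃ n, E n) + P {ω | ∃ n ≤ m, c < Λ n ω} :=
        (measure_mono hcover).trans ((measure_union_le _ _).trans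
          (add_le_add_left (measure_union_le _ _) _))
    _ ≤ _ := by gcongr

lemma mul_one_sub_le_lintegral [IsProbabilityMeasure P] (hT : Measurable T) (m : ℕ) :
    ((m + 1 : ℕ) : ℝ≥0∞) * (1 - P {ω | T ω ≤ m}) ≤ ∫⁻ ω, (T ω : ℝ≥0∞) ∂P := by
  have hcompl : {ω | ((m + 1 : ℕ) : ℝ≥0∞) ≤ (T ω : ℝ≥0∞)} = {ω | T ω ≤ m}ᶜ := by
    ext ω
    rw [Set.mem_compl_iff, Set.mem_ofPred_eq, Set.mem_ofPred_eq, not_le, ← ENat.toENNReal_coe,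
      ENat.toENNReal_le, Nat.cast_add_one, ENat.add_one_le_iff (ENat.natCast_ne_top m)]
  have hprob : P {ω | T ω ≤ m}ᶜ = 1 - P {ω | T ω ≤ m} :=
    prob_compl_eq_one_sub (hT (Set.to_countable (Set.Iic (m : ℕ∞))).measurableSet)
  rw [← hprob, ← hcompl]
  exact mul_meas_ge_le_lintegral ((measurable_of_countable _).comp hT) _

lemma tendsto_neg_log_fst_atTop :
    Tendsto (fun p : ℝ × ℝ => -Real.log p.1) (𝓝[>] 0 ×ˢ 𝓝[>] 0) atTop :=
  (tendsto_neg_atBot_atTop.comp Real.tendsto_log_nhdsGT_zero).comp tendsto_fst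

lemma tendsto_exp_floor_mul_zero {r s : ℝ} (hr : 0 < r) (hs : 0 < s) (hrs : s * r < 1) :
    Tendsto (fun p : ℝ × ℝ => ENNReal.ofReal (Real.exp (s * ⌊r * -Real.log p.1⌋₊)) *
      ENNReal.ofReal p.1) (𝓝[>] 0 ×ˢ 𝓝[>] 0) (𝓝 0) := by
  have hlim : Tendsto (fun p : ℝ × ℝ => ENNReal.ofReal (Real.exp (-((1 - s * r) * -Real.log p.1))))
      (𝓝[>] 0 ×ˢ 𝓝[>] 0) (𝓝 0) := by
    rw [← ENNReal.ofReal_zero]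
    exact ENNReal.tendsto_ofReal (Real.tendsto_exp_neg_atTop_nhds_zero.comp
      (tendsto_neg_log_fst_atTop.const_mul_atTop (sub_pos.2 hrs)))
  refine tendsto_of_tendsto_of_tendsto_of_le_of_le' tendsto_const_nhds hlim
    (Eventually.of_forall fun _ => zero_le) ?_
  filter_upwards [tendsto_fst.eventually eventually_mem_nhdsWithin,
    tendsto_neg_log_fst_atTop.eventually_ge_atTop 0] with p hp hx
  rw [← ENNReal.ofReal_mul (Real.exp_pos _).le]
  refine ENNReal.ofReal_le_ofReal ?_
  nth_rewrite 2 [← Real.exp_log hp]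
  rw [← Real.exp_add, Real.exp_le_exp]
  have hfloor : s * ⌊r * -Real.log p.1⌋₊ ≤ s * (r * -Real.log p.1) := by
    gcongr
    exact Nat.floor_le (by positivity)
  linarith

lemma GrowthLE.tendsto_error_bound [IsFiniteMeasure P] {R : ℝ} (h : GrowthLE P Λ R)
    (hΛ : ∀ n, Measurable (Λ n)) {r s : ℝ} (hr : 0 < r) (hs : 0 < s) (hRs : R < s)
    (hrs : s * r < 1) :
    Tendsto (fun p : ℝ × ℝ => ENNReal.ofReal p.2 +
      ENNReal.ofReal (Real.exp (s * ⌊r * -Real.log p.1⌋₊)) * ENNReal.ofReal p.1 +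
      P {ω | ∃ n ≤ ⌊r * -Real.log p.1⌋₊, s * ⌊r * -Real.log p.1⌋₊ < Λ n ω})
      (𝓝[>] 0 ×ˢ 𝓝[>] 0) (𝓝 0) := by
  have hβ : Tendsto (fun p : ℝ × ℝ => ENNReal.ofReal p.2) (𝓝[>] 0 ×ˢ 𝓝[>] 0) (𝓝 0) := by
    rw [← ENNReal.ofReal_zero]
    exact ENNReal.tendsto_ofReal
      ((tendsto_nhdsWithin_of_tendsto_nhds tendsto_id).comp tendsto_snd)
  have hexcess := (h.tendsto_measure_exists_lt hΛ hs hRs).comp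
    (tendsto_nat_floor_atTop.comp (tendsto_neg_log_fst_atTop.const_mul_atTop hr))
  simpa only [add_zero, Function.comp] using
    (hβ.add (tendsto_exp_floor_mul_zero hr hs hrs)).add hexcess

theorem eventually_le_lintegral_time [IsProbabilityMeasure P] (h : IsLogLR 𝓕 P Q Λ) {R : ℝ}
    (hR : 0 < R) (hΛ : GrowthLE P Λ R) {r : ℝ} (hr : r < 1 / R) :
    ∀ᶠ p : ℝ × ℝ in 𝓝[>] 0 ×ˢ 𝓝[>] 0, ∀ T D, IsDecision 𝓕 T D →
      Q {ω | D ω = true} ≤ ENNReal.ofReal p.1 → P {ω | D ω = false} ≤ ENNReal.ofReal p.2 →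
      ENNReal.ofReal (r * -Real.log p.1) ≤ ∫⁻ ω, (T ω : ℝ≥0∞) ∂P := by
  obtain ⟨r', hrr', hr'R⟩ := exists_between (max_lt hr (one_div_pos.2 hR))
  obtain ⟨hrr', hr'⟩ := max_lt_iff.1 hrr'
  obtain ⟨s, hRs, hsr'⟩ := exists_between ((lt_one_div hr' hR).1 hr'R)
  have hs : 0 < s := hR.trans hRs
  set m : ℝ × ℝ → ℕ := fun p => ⌊r' * -Real.log p.1⌋₊
  have herror := hΛ.tendsto_error_bound (fun n => (h.measurable n).mono (𝓕.le n) le_rfl) hr' hs hRs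
    ((lt_div_iff₀ hr').1 hsr')
  have hδ : (0 : ℝ≥0∞) < ENNReal.ofReal (1 - r / r') :=
    ENNReal.ofReal_pos.2 (sub_pos.2 ((div_lt_one hr').2 hrr'))
  filter_upwards [herror.eventually_le_const hδ, tendsto_neg_log_fst_atTop.eventually_ge_atTop 0]
    with p hp hx T D hT hα hβ
  have hPT : P {ω | T ω ≤ m p} ≤ ENNReal.ofReal (1 - r / r') :=
    (hT.measure_time_le_le h (m p) (s * m p)).trans ((by gcongr : _ ≤ _).trans hp)
  calc ENNReal.ofReal (r * -Real.log p.1)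
      = ENNReal.ofReal (r' * -Real.log p.1) * ENNReal.ofReal (r / r') := by
        rw [← ENNReal.ofReal_mul (by positivity)]
        congr 1
        field_simp
    _ ≤ ((m p + 1 : ℕ) : ℝ≥0∞) * (1 - P {ω | T ω ≤ m p}) := by
        gcongr
        · rw [← ENNReal.ofReal_natCast]
          refine ENNReal.ofReal_le_ofReal ?_
          push_cast
          exact (Nat.lt_floor_add_one _).le
        · refine le_trans ?_ (tsub_le_tsub_left hPT 1)
          rw [← ENNReal.ofReal_one,
            ← ENNReal.ofReal_sub _ (sub_nonneg.2 ((div_le_one hr').2 hrr'.le)), sub_sub_cancel]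
    _ ≤ ∫⁻ ω, (T ω : ℝ≥0∞) ∂P := mul_one_sub_le_lintegral hT.measurable_time (m p)

end LowerBound

section UpperBound

lemma toENNReal_eq_tsum (t : ℕ∞) :
    (t : ℝ≥0∞) = ∑' n : ℕ, if (n : ℕ∞) < t then (1 : ℝ≥0∞) else 0 := by
  cases t with
  | top => simp
  | coe t =>
    rw [tsum_eq_sum (s := Finset.range t) fun n hn => if_neg (by simpa using hn),
      Finset.sum_congr rfl fun n hn => if_pos (by simpa using hn)]
    simp

lemma toENNReal_le_of_forall_mem {t : ℕ∞} {M : ℕ} {E : Set ℕ}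
    (h : ∀ n : ℕ, M ≤ n → ((n + 1 : ℕ) : ℕ∞) < t → n ∈ E) :
    (t : ℝ≥0∞) ≤ 1 + M + ∑' n, E.indicator 1 n := by
  have hM := toENNReal_eq_tsum M
  rw [ENat.toENNReal_coe] at hM
  rw [toENNReal_eq_tsum, tsum_eq_zero_add' ENNReal.summable, add_assoc, hM, ← ENNReal.tsum_add]
  refine add_le_add (by split_ifs <;> simp) (ENNReal.tsum_le_tsum fun n => ?_)
  by_cases hn : ((n + 1 : ℕ) : ℕ∞) < t
  · rw [if_pos hn]
    rcases lt_or_ge n M with hnM | hMn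
    · rw [if_pos (by exact_mod_cast hnM)]
      exact le_self_add
    · rw [Set.indicator_of_mem (h n hMn hn)]
      exact le_add_self
  · rw [if_neg hn]
    exact zero_le

lemma natCast_ceil_le (x : ℝ) : (⌈x⌉₊ : ℝ≥0∞) ≤ ENNReal.ofReal x + 1 := by
  rw [← ENNReal.ofReal_natCast, ← ENNReal.ofReal_one]
  rcases le_total x 0 with hx | hx
  · simp [Nat.ceil_eq_zero.2 hx]
  · rw [← ENNReal.ofReal_add hx zero_le_one]
    exact ENNReal.ofReal_le_ofReal (Nat.ceil_lt_add_one hx).le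

theorem CompleteGrowthGE.exists_lintegral_le {Ω : Type*} [MeasurableSpace Ω] {P : Measure Ω}
    [IsProbabilityMeasure P] {Λ : ℕ → Ω → ℝ} {R r : ℝ} (h : CompleteGrowthGE P Λ R)
    (hΛ : ∀ n, Measurable (Λ n)) (hr : 0 < r) (hrR : r < R) :
    ∃ C < ∞, ∀ (a : ℝ) (T : Ω → ℕ∞), (∀ n : ℕ, 1 ≤ n → ∀ ω, a ≤ Λ n ω → T ω ≤ n) →
      ∫⁻ ω, (T ω : ℝ≥0∞) ∂P ≤ ENNReal.ofReal (a / r) + C := by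
  set G : ℕ → Set Ω := fun n => {ω | Λ (n + 1) ω / (n + 1 : ℕ) ≤ r}
  have hG : ∀ n, MeasurableSet (G n) := fun n =>
    measurableSet_le ((hΛ (n + 1)).div_const _) measurable_const
  refine ⟨1 + 1 + ∑' n, P (G n), ENNReal.add_lt_top.2 ⟨by simp, h r hrR⟩, fun a T hT => ?_⟩
  have hslow : ∀ ω, ∀ n : ℕ, ⌈a / r⌉₊ ≤ n → ((n + 1 : ℕ) : ℕ∞) < T ω → ω ∈ G n := by
    intro ω n hn hnT
    by_contra hω
    have hΛn : r < Λ (n + 1) ω / (n + 1 : ℕ) := not_le.1 hω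
    rw [lt_div_iff₀ (by positivity)] at hΛn
    refine not_le.2 hnT (hT (n + 1) (by omega) ω (le_trans ?_ hΛn.le))
    rw [← div_le_iff₀' hr]
    exact (Nat.ceil_le.1 hn).trans (by simp)
  calc ∫⁻ ω, (T ω : ℝ≥0∞) ∂P
      ≤ ∫⁻ ω, 1 + ⌈a / r⌉₊ + ∑' n, (G n).indicator 1 ω ∂P :=
        lintegral_mono fun ω => toENNReal_le_of_forall_mem (hslow ω)
    _ = 1 + ⌈a / r⌉₊ + ∑' n, P (G n) := by
        rw [lintegral_add_left measurable_const,
          lintegral_tsum fun n => (measurable_one.indicator (hG n)).aemeasurable]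
        simp [lintegral_indicator_one (hG _)]
    _ ≤ 1 + (ENNReal.ofReal (a / r) + 1) + ∑' n, P (G n) := by
        gcongr
        exact natCast_ceil_le _
    _ = ENNReal.ofReal (a / r) + (1 + 1 + ∑' n, P (G n)) := by ring

end UpperBound

section Exit

variable {Ω : Type*}

/-- The first time `n ≥ 1` at which the path is in `U n ∪ V n`. -/
noncomputable def firstExit (U V : ℕ → Set Ω) : Ω → ℕ∞ :=
  hittingAfter (fun n ω => ω ∈ U n ∪ V n) {p | p} 1

open Classical in
/-- The decision that is positive when the path is in `U n` at its first exit time `n`. -/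
noncomputable def exitDecision (U V : ℕ → Set Ω) (ω : Ω) : Bool :=
  decide (∃ n : ℕ, firstExit U V ω = n ∧ ω ∈ U n)

variable {U V : ℕ → Set Ω}

lemma one_le_firstExit (ω : Ω) : 1 ≤ firstExit U V ω := le_hittingAfter ω

lemma firstExit_le {ω : Ω} {n : ℕ} (hn : 1 ≤ n) (h : ω ∈ U n ∪ V n) : firstExit U V ω ≤ n :=
  hittingAfter_le_of_mem hn h

lemma mem_of_firstExit_eq {ω : Ω} {n : ℕ} (h : firstExit U V ω = n) : ω ∈ U n ∪ V n := by
  have hmem := hittingAfter_mem_set_of_ne_top (u := fun n ω => ω ∈ U n ∪ V n) (s := {p | p})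
    (n := 1) (ω := ω) (h.trans_ne (ENat.natCast_ne_top n))
  change ω ∈ U (WithTop.untopA (firstExit U V ω)) ∪ V (WithTop.untopA (firstExit U V ω)) at hmem
  rw [h] at hmem
  exact hmem

lemma exitDecision_eq_true_iff {ω : Ω} :
    exitDecision U V ω = true ↔ ∃ n : ℕ, firstExit U V ω = n ∧ ω ∈ U n := by
  simp [exitDecision]

lemma mem_iUnion_of_exitDecision_true {ω : Ω} (hD : exitDecision U V ω = true) :
    ω ∈ ⋃ n, U n := by
  obtain ⟨n, -, hn⟩ := exitDecision_eq_true_iff.1 hD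
  exact Set.mem_iUnion.2 ⟨n, hn⟩

lemma mem_iUnion_of_exitDecision_false {ω : Ω} (hT : firstExit U V ω < ⊤)
    (hD : exitDecision U V ω = false) : ω ∈ ⋃ n, V n := by
  obtain ⟨n, hn⟩ := ENat.ne_top_iff_exists.1 hT.ne
  refine Set.mem_iUnion.2 ⟨n, (mem_of_firstExit_eq hn.symm).resolve_left fun hU => ?_⟩
  exact Bool.false_ne_true (hD.symm.trans (exitDecision_eq_true_iff.2 ⟨n, hn.symm, hU⟩))

variable [mΩ : MeasurableSpace Ω] {𝓕 : Filtration ℕ mΩ}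

lemma IsDecision.of_true {T : Ω → ℕ∞} {D : Ω → Bool} (hT : ∀ ω, 1 ≤ T ω)
    (htime : ∀ n : ℕ, MeasurableSet[𝓕 n] {ω | T ω = n})
    (htrue : ∀ n : ℕ, MeasurableSet[𝓕 n] {ω | T ω = n ∧ D ω = true})
    (hD : ∀ ω, D ω = true → T ω ≠ ⊤) : IsDecision 𝓕 T D where
  one_le := hT
  measurable_D := by
    refine measurable_to_bool ?_
    have : D ⁻¹' {true} = ⋃ n : ℕ, {ω | T ω = n ∧ D ω = true} := by
      ext ω
      simp only [Set.mem_preimage, Set.mem_singleton_iff, Set.mem_iUnion]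
      refine ⟨fun h => ?_, fun ⟨_, h⟩ => h.2⟩
      obtain ⟨n, hn⟩ := ENat.ne_top_iff_exists.1 (hD ω h)
      exact ⟨n, hn.symm, h⟩
    rw [this]
    exact MeasurableSet.iUnion fun n => 𝓕.le n _ (htrue n)
  time := htime
  decision n i := by
    cases i with
    | true => exact htrue n
    | false =>
      have : {ω | T ω = n ∧ D ω = false} = {ω | T ω = n} \ {ω | T ω = n ∧ D ω = true} := by
        ext ω
        rw [Set.mem_sdiff]
        change _ ∧ _ ↔ _ = _ ∧ ¬(_ ∧ _)
        cases D ω <;> simp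
      rw [this]
      exact (htime n).diff (htrue n)

lemma isStoppingTime_firstExit (hU : ∀ n, MeasurableSet[𝓕 n] (U n))
    (hV : ∀ n, MeasurableSet[𝓕 n] (V n)) : IsStoppingTime 𝓕 (firstExit U V) :=
  Adapted.isStoppingTime_hittingAfter
    (fun n => (@measurableSet_setOfPred _ (𝓕 n) _).1 ((hU n).union (hV n))) trivial

lemma isDecision_firstExit (hU : ∀ n, MeasurableSet[𝓕 n] (U n))
    (hV : ∀ n, MeasurableSet[𝓕 n] (V n)) :
    IsDecision 𝓕 (firstExit U V) (exitDecision U V) := by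
  have htime : ∀ n : ℕ, MeasurableSet[𝓕 n] {ω | firstExit U V ω = n} :=
    (isStoppingTime_firstExit hU hV).measurableSet_eq
  refine .of_true one_le_firstExit htime (fun n => ?_) fun ω hω => ?_
  · have : {ω | firstExit U V ω = n ∧ exitDecision U V ω = true}
        = {ω | firstExit U V ω = n} ∩ U n := by
      ext ω
      refine and_congr_right fun hn => ⟨fun h => ?_, fun h => exitDecision_eq_true_iff.2 ⟨n, hn, h⟩⟩
      obtain ⟨m, hm, hmU⟩ := exitDecision_eq_true_iff.1 h
      rwa [Nat.cast_inj.1 (hn.symm.trans hm)]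
    rw [this]
    exact (htime n).inter (hU n)
  · obtain ⟨n, hn, -⟩ := exitDecision_eq_true_iff.1 hω
    exact hn.trans_ne (ENat.natCast_ne_top n)

end Exit

section Stream

variable {S : Type*} [MeasurableSpace S]

/-- The filtration of one stream. -/
def pathFiltration (S : Type*) [MeasurableSpace S] :
    Filtration ℕ (MeasurableSpace.pi : MeasurableSpace (ℕ → S)) where
  seq := pathSigma S
  mono' _ _ h := cylinderEvents_mono (Set.Iio_subset_Iio h)
  le' _ := cylinderEvents_le_pi

lemma measurable_logLR (P₀ P₁ : Measure (ℕ → S)) (n : ℕ) : Measurable (logLR P₀ P₁ n) :=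
  Measurable.mono (@measurable_llr _ (pathSigma S n) (restr P₁ n) (restr P₀ n))
    cylinderEvents_le_pi le_rfl

variable {P₀ P₁ : Measure (ℕ → S)} [IsProbabilityMeasure P₀] [IsProbabilityMeasure P₁] {I J : ℝ}

instance isFiniteMeasure_restr (n : ℕ) : IsFiniteMeasure (restr P₀ n) := by
  unfold restr
  infer_instance

lemma StreamAssumptions.isLogLR (h : StreamAssumptions P₀ P₁ I J) :
    IsLogLR (pathFiltration S) P₁ P₀ (logLR P₀ P₁) where
  measurable n := @measurable_llr _ (pathSigma S n) (restr P₁ n) (restr P₀ n)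
  trim_eq n := by
    refine (Measure.withDensity_rnDeriv_eq _ _ (h.ac₁ n)).symm.trans (withDensity_congr_ae ?_)
    filter_upwards [exp_llr_of_ac' _ _ (h.ac₀ n), Measure.rnDeriv_lt_top (restr P₁ n) (restr P₀ n)]
      with x hx hx'
    rw [logLR, hx, ENNReal.ofReal_toReal hx'.ne]

lemma logLR_swap_ae (h : ∀ n, restr P₁ n ≪ restr P₀ n) :
    ∀ᵐ x ∂P₁, ∀ n, logLR P₁ P₀ n x = -logLR P₀ P₁ n x :=
  ae_all_iff.2 fun n =>
    ae_of_ae_trim cylinderEvents_le_pi ((neg_llr (h n)).mono fun _ hx => hx.symm)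

lemma StreamAssumptions.swap (h : StreamAssumptions P₀ P₁ I J) :
    StreamAssumptions P₁ P₀ J I where
  I_pos := h.J_pos
  J_pos := h.I_pos
  ac₁ := h.ac₀
  ac₀ := h.ac₁
  limsup₁ := by
    filter_upwards [h.limsup₀, logLR_swap_ae h.ac₀] with x hx hs
    simpa only [hs, neg_neg] using hx
  limsup₀ := by
    filter_upwards [h.limsup₁, logLR_swap_ae h.ac₁] with x hx hs
    simpa only [hs, neg_neg] using hx
  complete₁ ε hε := by
    refine (tsum_congr fun n => measure_congr ?_).trans_lt (h.complete₀ ε hε)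
    filter_upwards [logLR_swap_ae h.ac₀] with x hx
    exact congrArg (fun y : ℝ => y / ((n + 1 : ℕ) : ℝ) ≤ J - ε) (neg_eq_iff_eq_neg.2 (hx _)).symm
  complete₀ ε hε := by
    refine (tsum_congr fun n => measure_congr ?_).trans_lt (h.complete₁ ε hε)
    filter_upwards [logLR_swap_ae h.ac₁] with x hx
    exact congrArg (fun y : ℝ => y / ((n + 1 : ℕ) : ℝ) ≤ I - ε) (neg_eq_iff_eq_neg.2 (hx _))

end Stream

section Streams

variable {K : ℕ} {S : Fin K → Type*} [∀ k, MeasurableSpace (S k)]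

/-- The filtration of all streams. -/
def globalFiltration (S : Fin K → Type*) [∀ k, MeasurableSpace (S k)] :
    Filtration ℕ (MeasurableSpace.pi : MeasurableSpace (∀ k, ℕ → S k)) where
  seq := globalSigma S
  mono' _ _ h := iSup_mono fun k => MeasurableSpace.comap_mono ((pathFiltration (S k)).mono h)
  le' n := iSup_mono fun k => MeasurableSpace.comap_mono ((pathFiltration (S k)).le n)

/-- The filtration of stream `k` alone, on the joint path space. -/
def localFiltration (S : Fin K → Type*) [∀ k, MeasurableSpace (S k)] (k : Fin K) :
    Filtration ℕ (MeasurableSpace.pi : MeasurableSpace (∀ k, ℕ → S k)) where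
  seq := localSigma S k
  mono' _ _ h := MeasurableSpace.comap_mono ((pathFiltration (S k)).mono h)
  le' n := (le_iSup (fun k => localSigma S k n) k).trans ((globalFiltration S).le n)

lemma localFiltration_le_globalFiltration (k : Fin K) : localFiltration S k ≤ globalFiltration S :=
  fun n => le_iSup (fun k => localSigma S k n) k

variable (P₀ P₁ : ∀ k, Measure (ℕ → S k))

/-- The log-likelihood ratio `λ_k(n)` of stream `k`, as a process on the joint path space. -/
noncomputable def streamLLR (k : Fin K) (n : ℕ) (ω : ∀ k, ℕ → S k) : ℝ :=
  logLR (P₀ k) (P₁ k) n (ω k)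

lemma measurable_localSigma_streamLLR (k : Fin K) (n : ℕ) :
    Measurable[localSigma S k n] (streamLLR P₀ P₁ k n) :=
  (@measurable_llr _ (pathSigma (S k) n) (restr (P₁ k) n) (restr (P₀ k) n)).comp
    (comap_measurable _)

lemma measurable_globalSigma_streamLLR (k : Fin K) (n : ℕ) :
    Measurable[globalSigma S n] (streamLLR P₀ P₁ k n) :=
  (measurable_localSigma_streamLLR P₀ P₁ k n).mono (localFiltration_le_globalFiltration k n) le_rfl

lemma measurable_streamLLR (k : Fin K) (n : ℕ) : Measurable (streamLLR P₀ P₁ k n) :=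
  (measurable_localSigma_streamLLR P₀ P₁ k n).mono ((localFiltration S k).le n) le_rfl

variable {P₀ P₁} [∀ k, IsProbabilityMeasure (P₀ k)] [∀ k, IsProbabilityMeasure (P₁ k)]

instance isProbabilityMeasure_ite (A : Finset (Fin K)) (k : Fin K) :
    IsProbabilityMeasure (if k ∈ A then P₁ k else P₀ k) := by
  split_ifs <;> infer_instance

instance isProbabilityMeasure_jointLaw (A : Finset (Fin K)) :
    IsProbabilityMeasure (jointLaw P₀ P₁ A) := by
  unfold jointLaw
  infer_instance

variable {A : Finset (Fin K)} {k : Fin K}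

lemma measurePreserving_jointLaw_of_mem (hk : k ∈ A) :
    MeasurePreserving (fun ω : ∀ k, ℕ → S k => ω k) (jointLaw P₀ P₁ A) (P₁ k) := by
  have h := measurePreserving_eval (fun k => if k ∈ A then P₁ k else P₀ k) k
  rw [if_pos hk] at h
  exact h

lemma measurePreserving_jointLaw_of_notMem (hk : k ∉ A) :
    MeasurePreserving (fun ω : ∀ k, ℕ → S k => ω k) (jointLaw P₀ P₁ A) (P₀ k) := by
  have h := measurePreserving_eval (fun k => if k ∈ A then P₁ k else P₀ k) k
  rw [if_neg hk] at h
  exact h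

lemma growthLE_streamLLR {I J : ℝ} (h : StreamAssumptions (P₀ k) (P₁ k) I J) (hk : k ∈ A) :
    GrowthLE (jointLaw P₀ P₁ A) (streamLLR P₀ P₁ k) I :=
  (growthLE_of_limsup_le h.limsup₁).comp (measurePreserving_jointLaw_of_mem hk)

lemma growthLE_neg_streamLLR {I J : ℝ} (h : StreamAssumptions (P₀ k) (P₁ k) I J) (hk : k ∉ A) :
    GrowthLE (jointLaw P₀ P₁ A) (-streamLLR P₀ P₁ k) J :=
  (growthLE_of_limsup_le (Λ := -logLR (P₀ k) (P₁ k)) h.limsup₀).comp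
    (measurePreserving_jointLaw_of_notMem hk)

lemma completeGrowthGE_streamLLR {I J : ℝ} (h : StreamAssumptions (P₀ k) (P₁ k) I J)
    (hk : k ∈ A) : CompleteGrowthGE (jointLaw P₀ P₁ A) (streamLLR P₀ P₁ k) I :=
  (completeGrowthGE_of_forall_pos h.complete₁).comp (measurable_logLR _ _)
    (measurePreserving_jointLaw_of_mem hk)

lemma completeGrowthGE_neg_streamLLR {I J : ℝ} (h : StreamAssumptions (P₀ k) (P₁ k) I J)
    (hk : k ∉ A) : CompleteGrowthGE (jointLaw P₀ P₁ A) (-streamLLR P₀ P₁ k) J :=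
  (completeGrowthGE_of_forall_pos (Λ := -logLR (P₀ k) (P₁ k)) h.complete₀).comp
    (fun n => (measurable_logLR _ _ n).neg) (measurePreserving_jointLaw_of_notMem hk)

lemma isLogLR_localFiltration {I J : ℝ} (h : StreamAssumptions (P₀ k) (P₁ k) I J)
    {B : Finset (Fin K)} (hA : k ∈ A) (hB : k ∉ B) :
    IsLogLR (localFiltration S k) (jointLaw P₀ P₁ A) (jointLaw P₀ P₁ B) (streamLLR P₀ P₁ k) :=
  h.isLogLR.comp (fun _ => rfl) (measurePreserving_jointLaw_of_mem hA)
    (measurePreserving_jointLaw_of_notMem hB)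

variable {I J : Fin K → ℝ}

lemma isLogLR_globalFiltration (h : ∀ k, StreamAssumptions (P₀ k) (P₁ k) (I k) (J k))
    (A B : Finset (Fin K)) :
    IsLogLR (globalFiltration S) (jointLaw P₀ P₁ A) (jointLaw P₀ P₁ B)
      (∑ k ∈ A, streamLLR P₀ P₁ k - ∑ k ∈ B, streamLLR P₀ P₁ k) := by
  set Λ : ∀ k, ℕ → (ℕ → S k) → ℝ := fun k =>
    (if k ∈ A then logLR (P₀ k) (P₁ k) else 0) - if k ∈ B then logLR (P₀ k) (P₁ k) else 0
  have hstream : ∀ k, IsLogLR (pathFiltration (S k)) (if k ∈ A then P₁ k else P₀ k)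
      (if k ∈ B then P₁ k else P₀ k) (Λ k) := by
    intro k
    simp only [Λ]
    split_ifs
    · rw [sub_self]
      exact .refl _ _
    · rw [sub_zero]
      exact (h k).isLogLR
    · rw [zero_sub]
      exact (h k).isLogLR.symm
    · rw [sub_self]
      exact .refl _ _
  have hsum : ∑ k ∈ A, streamLLR P₀ P₁ k - ∑ k ∈ B, streamLLR P₀ P₁ k =
      fun n ω => ∑ k, Λ k n (ω k) := by
    ext n ω
    simp only [Λ, Pi.sub_apply, Finset.sum_apply, Finset.sum_sub_distrib, ite_apply, Pi.zero_apply,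
      Finset.sum_ite_mem, Finset.univ_inter, streamLLR]
  rw [hsum]
  exact .pi hstream fun _ => rfl

lemma isLogLR_insert (h : ∀ k, StreamAssumptions (P₀ k) (P₁ k) (I k) (J k)) (hk : k ∉ A) :
    IsLogLR (globalFiltration S) (jointLaw P₀ P₁ (insert k A)) (jointLaw P₀ P₁ A)
      (streamLLR P₀ P₁ k) := by
  simpa only [Finset.sum_insert hk, add_sub_cancel_right] using
    isLogLR_globalFiltration h (insert k A) A

lemma isLogLR_insert_erase (h : ∀ k, StreamAssumptions (P₀ k) (P₁ k) (I k) (J k)) {j : Fin K}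
    (hk : k ∉ A) (hj : j ∈ A) :
    IsLogLR (globalFiltration S) (jointLaw P₀ P₁ (insert k (A.erase j))) (jointLaw P₀ P₁ A)
      (streamLLR P₀ P₁ k - streamLLR P₀ P₁ j) := by
  have hsum : ∑ k ∈ insert k (A.erase j), streamLLR P₀ P₁ k - ∑ k ∈ A, streamLLR P₀ P₁ k =
      streamLLR P₀ P₁ k - streamLLR P₀ P₁ j := by
    rw [Finset.sum_insert fun hk' => hk (Finset.mem_of_mem_erase hk'), Finset.sum_erase_eq_sub hj]
    abel
  rw [← hsum]
  exact isLogLR_globalFiltration h _ _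

end Streams

section GapProcedure

variable {K : ℕ} {S : Fin K → Type*} [∀ k, MeasurableSpace (S k)]

section Definitions

variable (P₀ P₁ : ∀ k, Measure (ℕ → S k)) (A : Finset (Fin K)) (a b : ℝ) (k : Fin K) (n : ℕ)

/-- The event on which, at time `n`, the gap procedure tuned to `A` has enough evidence that
stream `k` is a signal: either its log-likelihood ratio is large, or `k ∈ A` and its
log-likelihood ratio exceeds those of all streams outside `A` by a large amount. -/
def signalRegion : Set (∀ k, ℕ → S k) :=
  {ω | a ≤ streamLLR P₀ P₁ k n ω} ∪
    {ω | k ∈ A ∧ ∀ j ∉ A, a ≤ (streamLLR P₀ P₁ k - streamLLR P₀ P₁ j) n ω}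

/-- The event on which, at time `n`, the gap procedure has enough evidence that stream `k` is
noise. -/
def noiseRegion : Set (∀ k, ℕ → S k) :=
  {ω | b ≤ (-streamLLR P₀ P₁ k) n ω}

lemma signalRegion_empty :
    signalRegion P₀ P₁ ∅ a k n = {ω | a ≤ streamLLR P₀ P₁ k n ω} := by
  simp [signalRegion]

lemma measurableSet_signalRegion : MeasurableSet[globalSigma S n] (signalRegion P₀ P₁ A a k n) := by
  refine (measurable_globalSigma_streamLLR P₀ P₁ k n measurableSet_Ici).union ?_
  by_cases hk : k ∈ A
  · have : {ω | k ∈ A ∧ ∀ j ∉ A, a ≤ (streamLLR P₀ P₁ k - streamLLR P₀ P₁ j) n ω} =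
        ⋂ j ∈ Aᶜ, {ω | a ≤ (streamLLR P₀ P₁ k - streamLLR P₀ P₁ j) n ω} := by
      ext ω
      simp [hk]
    rw [this]
    exact Finset.measurableSet_biInter _ fun j _ =>
      (Measurable.sub (measurable_globalSigma_streamLLR P₀ P₁ k n)
        (measurable_globalSigma_streamLLR P₀ P₁ j n)) measurableSet_Ici
  · simp [hk]

lemma measurableSet_noiseRegion : MeasurableSet[localSigma S k n] (noiseRegion P₀ P₁ b k n) :=
  (Measurable.neg (measurable_localSigma_streamLLR P₀ P₁ k n)) measurableSet_Ici

/-- The gap procedure tuned to the set of signals `A`, with thresholds `a` and `b`.  It depends on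
the unknown `A`, which is harmless: the optimal expected times are infima for a fixed `A`.  For
`A = ∅` it consists of parallel sequential probability ratio tests. -/
noncomputable def gapProcedure : Procedure S where
  T k := firstExit (signalRegion P₀ P₁ A a k) (noiseRegion P₀ P₁ b k)
  D k := exitDecision (signalRegion P₀ P₁ A a k) (noiseRegion P₀ P₁ b k)
  isDecision k := isDecision_firstExit (𝓕 := globalFiltration S)
    (measurableSet_signalRegion P₀ P₁ A a k)
    fun n => localFiltration_le_globalFiltration k n _ (measurableSet_noiseRegion P₀ P₁ b k n)

lemma decentralized_gapProcedure_empty : (gapProcedure P₀ P₁ ∅ a b).Decentralized := fun k => by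
  refine isDecision_firstExit (𝓕 := localFiltration S k) (fun n => ?_)
    (measurableSet_noiseRegion P₀ P₁ b k)
  rw [signalRegion_empty]
  exact measurable_localSigma_streamLLR P₀ P₁ k n measurableSet_Ici

lemma gapProcedure_T_le {ω : ∀ k, ℕ → S k} {k : Fin K} {n : ℕ} (hn : 1 ≤ n)
    (hω : ω ∈ signalRegion P₀ P₁ A a k n ∪ noiseRegion P₀ P₁ b k n) :
    (gapProcedure P₀ P₁ A a b).T k ω ≤ n :=
  firstExit_le hn hω

end Definitions

variable {P₀ P₁ : ∀ k, Measure (ℕ → S k)} [∀ k, IsProbabilityMeasure (P₀ k)]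
    [∀ k, IsProbabilityMeasure (P₁ k)] {I J : Fin K → ℝ} {A B : Finset (Fin K)} {a b : ℝ}
    {k : Fin K} {Pr : Set (Finset (Fin K))} {α β : ℝ}

lemma expTime_gapProcedure_lt_top (h : ∀ k, StreamAssumptions (P₀ k) (P₁ k) (I k) (J k))
    (k : Fin K) (A B : Finset (Fin K)) (a b : ℝ) :
    (gapProcedure P₀ P₁ A a b).expTime P₀ P₁ k B < ∞ := by
  by_cases hk : k ∈ B
  · obtain ⟨C, hC, hle⟩ := (completeGrowthGE_streamLLR (h k) hk).exists_lintegral_le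
      (measurable_streamLLR P₀ P₁ k) (half_pos (h k).I_pos) (half_lt_self (h k).I_pos)
    exact (hle a ((gapProcedure P₀ P₁ A a b).T k) fun n hn ω hω =>
      gapProcedure_T_le _ _ _ _ _ hn (Or.inl (Or.inl hω))).trans_lt
      (ENNReal.add_lt_top.2 ⟨ENNReal.ofReal_lt_top, hC⟩)
  · obtain ⟨C, hC, hle⟩ := (completeGrowthGE_neg_streamLLR (h k) hk).exists_lintegral_le
      (fun n => (measurable_streamLLR P₀ P₁ k n).neg) (half_pos (h k).J_pos)
      (half_lt_self (h k).J_pos)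
    exact (hle b ((gapProcedure P₀ P₁ A a b).T k) fun n hn ω hω =>
      gapProcedure_T_le _ _ _ _ _ hn (Or.inr hω)).trans_lt
      (ENNReal.add_lt_top.2 ⟨ENNReal.ofReal_lt_top, hC⟩)

lemma ae_gapProcedure_lt_top (h : ∀ k, StreamAssumptions (P₀ k) (P₁ k) (I k) (J k)) (k : Fin K)
    (A B : Finset (Fin K)) (a b : ℝ) :
    ∀ᵐ ω ∂(jointLaw P₀ P₁ B), (gapProcedure P₀ P₁ A a b).T k ω < ⊤ := by
  have hT : Measurable ((gapProcedure P₀ P₁ A a b).T k) :=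
    IsDecision.measurable_time (𝓕 := globalFiltration S) ((gapProcedure P₀ P₁ A a b).isDecision k)
  filter_upwards [ae_lt_top ((measurable_of_countable _).comp hT)
    (expTime_gapProcedure_lt_top h k A B a b).ne] with ω hω
  simpa using hω

lemma jointLaw_iUnion_signalRegion_le (h : ∀ k, StreamAssumptions (P₀ k) (P₁ k) (I k) (J k))
    (hBA : B ⊆ A → A ⊆ B) (hk : k ∉ B) :
    jointLaw P₀ P₁ B (⋃ n, signalRegion P₀ P₁ A a k n) ≤ 2 * ENNReal.ofReal (Real.exp (-a)) := by
  have hgap : jointLaw P₀ P₁ B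
      (⋃ n, {ω | k ∈ A ∧ ∀ j ∉ A, a ≤ (streamLLR P₀ P₁ k - streamLLR P₀ P₁ j) n ω}) ≤
        ENNReal.ofReal (Real.exp (-a)) := by
    by_cases hkA : k ∈ A
    · obtain ⟨j, hjB, hjA⟩ := Finset.not_subset.1 fun hB => hk (hBA hB hkA)
      refine (measure_mono ?_).trans ((isLogLR_insert_erase h hk hjB).measure_iUnion_le_of_le a)
      exact Set.iUnion_mono fun n ω hω => hω.2 j hjA
    · simp [hkA]
  simp only [signalRegion, Set.iUnion_union_distrib]
  rw [two_mul]
  exact (measure_union_le _ _).trans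
    (add_le_add ((isLogLR_insert h hk).measure_iUnion_le_of_le a) hgap)

lemma jointLaw_iUnion_noiseRegion_le (h : ∀ k, StreamAssumptions (P₀ k) (P₁ k) (I k) (J k))
    (hk : k ∈ B) :
    jointLaw P₀ P₁ B (⋃ n, noiseRegion P₀ P₁ b k n) ≤ ENNReal.ofReal (Real.exp (-b)) := by
  have hB := (isLogLR_insert h (Finset.notMem_erase k B)).symm
  rw [Finset.insert_erase hk] at hB
  exact hB.measure_iUnion_le_of_le b

lemma sum_le_mul_of_forall_le {s : Finset (Fin K)} {f : Fin K → ℝ≥0∞} {c : ℝ≥0∞}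
    (hf : ∀ k ∈ s, f k ≤ c) : ∑ k ∈ s, f k ≤ K * c := by
  refine (Finset.sum_le_card_nsmul s f c hf).trans ?_
  rw [nsmul_eq_mul]
  gcongr
  exact card_finset_fin_le s

lemma fwe₁_gapProcedure_le (h : ∀ k, StreamAssumptions (P₀ k) (P₁ k) (I k) (J k))
    (hBA : B ⊆ A → A ⊆ B) :
    (gapProcedure P₀ P₁ A a b).fwe₁ P₀ P₁ B ≤ K * (2 * ENNReal.ofReal (Real.exp (-a))) := by
  have hsub : {ω | ∃ k, k ∉ B ∧ (gapProcedure P₀ P₁ A a b).D k ω = true} ⊆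
      ⋃ k ∈ Bᶜ, ⋃ n, signalRegion P₀ P₁ A a k n := by
    rintro ω ⟨k, hk, hD⟩
    exact Set.mem_biUnion (Finset.mem_compl.2 hk) (mem_iUnion_of_exitDecision_true hD)
  refine (measure_mono hsub).trans ((measure_biUnion_finset_le _ _).trans ?_)
  exact sum_le_mul_of_forall_le fun k hk =>
    jointLaw_iUnion_signalRegion_le h hBA (Finset.mem_compl.1 hk)

lemma fwe₂_gapProcedure_le (h : ∀ k, StreamAssumptions (P₀ k) (P₁ k) (I k) (J k)) :
    (gapProcedure P₀ P₁ A a b).fwe₂ P₀ P₁ B ≤ K * ENNReal.ofReal (Real.exp (-b)) := by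
  have hsub : ∀ᵐ ω ∂(jointLaw P₀ P₁ B),
      (∃ k, k ∈ B ∧ (gapProcedure P₀ P₁ A a b).D k ω = false) →
        ω ∈ ⋃ k ∈ B, ⋃ n, noiseRegion P₀ P₁ b k n := by
    filter_upwards [ae_all_iff.2 fun k => ae_gapProcedure_lt_top h k A B a b] with ω hT ⟨k, hk, hD⟩
    exact Set.mem_biUnion hk (mem_iUnion_of_exitDecision_false (hT k) hD)
  refine (measure_mono_ae hsub).trans ((measure_biUnion_finset_le _ _).trans ?_)
  exact sum_le_mul_of_forall_le fun k hk => jointLaw_iUnion_noiseRegion_le h hk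

/-- The threshold `-log x + log (2 K)` of the gap procedure for the error level `x`; the second
term pays for a union bound over the streams and the two ways to declare a signal. -/
noncomputable def gapThreshold (K : ℕ) (x : ℝ) : ℝ := -Real.log x + Real.log (2 * K)

lemma natCast_mul_two_mul_exp_gapThreshold {x : ℝ} (hK : 0 < K) (hx : 0 < x) :
    K * (2 * ENNReal.ofReal (Real.exp (-gapThreshold K x))) = ENNReal.ofReal x := by
  have hK' : (0 : ℝ) < 2 * K := by positivity
  have hexp : Real.exp (-gapThreshold K x) = x / (2 * K) := by
    rw [gapThreshold, neg_add, neg_neg, ← sub_eq_add_neg, Real.exp_sub, Real.exp_log hx,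
      Real.exp_log hK']
  rw [hexp, ← ENNReal.ofReal_natCast, ← ENNReal.ofReal_ofNat, ← ENNReal.ofReal_mul zero_le_two,
    ← ENNReal.ofReal_mul K.cast_nonneg]
  congr 1
  field_simp

lemma gapProcedure_mem_controlled (h : ∀ k, StreamAssumptions (P₀ k) (P₁ k) (I k) (J k))
    (hK : 0 < K) (hA : ∀ B ∈ Pr, B ⊆ A → A ⊆ B) (hα : 0 < α) (hβ : 0 < β) :
    gapProcedure P₀ P₁ A (gapThreshold K α) (gapThreshold K β) ∈ controlled P₀ P₁ Pr α β := by
  refine fun B hB => ⟨fun k => ae_gapProcedure_lt_top h k A B _ _, ?_, ?_⟩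
  · rw [← natCast_mul_two_mul_exp_gapThreshold hK hα]
    exact fwe₁_gapProcedure_le h (hA B hB)
  · rw [← natCast_mul_two_mul_exp_gapThreshold hK hβ]
    refine (fwe₂_gapProcedure_le h).trans ?_
    gcongr
    exact le_mul_of_one_le_left' one_le_two

end GapProcedure

section Asymptotics

/-- `f (α, β)` is asymptotic to `c * |log α|` as `α` and `β` tend to `0` from above. -/
def HasLogSlope (f : ℝ × ℝ → ℝ≥0∞) (c : ℝ≥0∞) : Prop :=
  Tendsto (fun p => f p / ENNReal.ofReal (-Real.log p.1)) (𝓝[>] 0 ×ˢ 𝓝[>] 0) (𝓝 c)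

variable {f g : ℝ × ℝ → ℝ≥0∞} {R : ℝ}

lemma eventually_lt_div_neg_log
    (hf : ∀ r < 1 / R, ∀ᶠ p : ℝ × ℝ in 𝓝[>] 0 ×ˢ 𝓝[>] 0,
      ENNReal.ofReal (r * -Real.log p.1) ≤ f p) {a : ℝ≥0∞} (ha : a < ENNReal.ofReal (1 / R)) :
    ∀ᶠ p : ℝ × ℝ in 𝓝[>] 0 ×ˢ 𝓝[>] 0, a < f p / ENNReal.ofReal (-Real.log p.1) := by
  obtain ⟨s, hs, has, hsR⟩ := ENNReal.lt_iff_exists_real_btwn.1 ha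
  have hsR' : s < 1 / R := (ENNReal.ofReal_lt_ofReal_iff_of_nonneg hs).1 hsR
  filter_upwards [tendsto_neg_log_fst_atTop.eventually_gt_atTop 0, hf s hsR'] with p hp hle
  refine has.trans_le ?_
  rwa [ENNReal.le_div_iff_mul_le (Or.inl (ENNReal.ofReal_pos.2 hp).ne')
    (Or.inl ENNReal.ofReal_ne_top), ← ENNReal.ofReal_mul hs]

lemma eventually_div_neg_log_lt (hR : 0 < R)
    (hf : ∀ r : ℝ, 0 < r → r < R → ∃ (c : ℝ) (C : ℝ≥0∞), C < ∞ ∧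
      ∀ᶠ p : ℝ × ℝ in 𝓝[>] 0 ×ˢ 𝓝[>] 0, f p ≤ ENNReal.ofReal ((-Real.log p.1 + c) / r) + C)
    {b : ℝ≥0∞} (hb : ENNReal.ofReal (1 / R) < b) :
    ∀ᶠ p : ℝ × ℝ in 𝓝[>] 0 ×ˢ 𝓝[>] 0, f p / ENNReal.ofReal (-Real.log p.1) < b := by
  have hR' : 0 < 1 / R := one_div_pos.2 hR
  obtain ⟨q, -, hRq, hqb⟩ := ENNReal.lt_iff_exists_real_btwn.1 hb
  have hRq' : 1 / R < q := (ENNReal.ofReal_lt_ofReal_iff_of_nonneg hR'.le).1 hRq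
  have hq0 : 0 < q := hR'.trans hRq'
  obtain ⟨r, hqr, hrR⟩ := exists_between ((one_div_lt hR hq0).1 hRq')
  have hr : 0 < r := (one_div_pos.2 hq0).trans hqr
  obtain ⟨c, C, hC, hle⟩ := hf r hr hrR
  have hslope : 0 < q - 1 / r := sub_pos.2 ((one_div_lt hq0 hr).1 hqr)
  filter_upwards [tendsto_neg_log_fst_atTop.eventually_ge_atTop (-c), hle,
    (tendsto_neg_log_fst_atTop.const_mul_atTop hslope).eventually_ge_atTop (c / r + C.toReal)]
    with p hpc hle hpC
  refine (ENNReal.div_le_of_le_mul (hle.trans ?_)).trans_lt hqb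
  rw [← ENNReal.ofReal_toReal hC.ne, ← ENNReal.ofReal_mul hq0.le, ← ENNReal.ofReal_add
    (div_nonneg (neg_le_iff_add_nonneg.1 hpc) hr.le) ENNReal.toReal_nonneg]
  refine ENNReal.ofReal_le_ofReal ?_
  rw [sub_mul, one_div_mul_eq_div] at hpC
  rw [add_div]
  linarith

lemma hasLogSlope_of_bounds (hR : 0 < R)
    (hlow : ∀ r < 1 / R, ∀ᶠ p : ℝ × ℝ in 𝓝[>] 0 ×ˢ 𝓝[>] 0,
      ENNReal.ofReal (r * -Real.log p.1) ≤ f p)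
    (hup : ∀ r : ℝ, 0 < r → r < R → ∃ (c : ℝ) (C : ℝ≥0∞), C < ∞ ∧
      ∀ᶠ p : ℝ × ℝ in 𝓝[>] 0 ×ˢ 𝓝[>] 0, f p ≤ ENNReal.ofReal ((-Real.log p.1 + c) / r) + C) :
    HasLogSlope f (ENNReal.ofReal (1 / R)) :=
  tendsto_order.2 ⟨fun _ => eventually_lt_div_neg_log hlow,
    fun _ => eventually_div_neg_log_lt hR hup⟩

lemma HasLogSlope.tendsto_div {a b : ℝ≥0∞} (hf : HasLogSlope f a) (hg : HasLogSlope g b)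
    (ha : a ≠ 0) (hb : b ≠ ∞) :
    Tendsto (fun p => f p / g p) (𝓝[>] 0 ×ˢ 𝓝[>] 0) (𝓝 (a / b)) := by
  refine (ENNReal.Tendsto.div hf (Or.inl ha) hg (Or.inl hb)).congr' ?_
  filter_upwards [tendsto_neg_log_fst_atTop.eventually_gt_atTop 0] with p hp
  have hinv0 := ENNReal.inv_ne_zero.2 (ENNReal.ofReal_ne_top (r := -Real.log p.1))
  have hinv := ENNReal.inv_ne_top.2 (ENNReal.ofReal_pos.2 hp).ne'
  rw [div_eq_mul_inv (f p), div_eq_mul_inv (g p), ENNReal.mul_div_mul_right _ _ hinv0 hinv]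

end Asymptotics

section OptimalTimes

variable {K : ℕ} {S : Fin K → Type*} [∀ k, MeasurableSpace (S k)]
    {P₀ P₁ : ∀ k, Measure (ℕ → S k)} {Pr : Set (Finset (Fin K))} {A B : Finset (Fin K)}
    {i j : Fin K} {R : ℝ} {Λ : ℕ → (∀ k, ℕ → S k) → ℝ}

lemma optTime_le_optTimeDec (α β : ℝ) :
    optTime P₀ P₁ Pr i A α β ≤ optTimeDec P₀ P₁ Pr i A α β :=
  biInf_mono fun _ hχ => hχ.2

variable [∀ k, IsProbabilityMeasure (P₀ k)] [∀ k, IsProbabilityMeasure (P₁ k)]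

lemma eventually_le_expTime
    {𝓕 : Filtration ℕ (MeasurableSpace.pi : MeasurableSpace (∀ k, ℕ → S k))}
    (hΛ : IsLogLR 𝓕 (jointLaw P₀ P₁ A) (jointLaw P₀ P₁ B) Λ)
    (hgrowth : GrowthLE (jointLaw P₀ P₁ A) Λ R) (hR : 0 < R) (hA : A ∈ Pr) (hB : B ∈ Pr)
    (hiA : i ∈ A) (hiB : i ∉ B) {r : ℝ} (hr : r < 1 / R) :
    ∀ᶠ p : ℝ × ℝ in 𝓝[>] 0 ×ˢ 𝓝[>] 0, ∀ χ ∈ controlled P₀ P₁ Pr p.1 p.2,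
      IsDecision 𝓕 (χ.T i) (χ.D i) →
        ENNReal.ofReal (r * -Real.log p.1) ≤ χ.expTime P₀ P₁ i A := by
  filter_upwards [eventually_le_lintegral_time hΛ hR hgrowth hr] with p hp χ hχ hdec
  exact hp _ _ hdec ((measure_mono fun _ hω => Exists.intro i ⟨hiB, hω⟩).trans (hχ B hB).2.1)
    ((measure_mono fun _ hω => Exists.intro i ⟨hiA, hω⟩).trans (hχ A hA).2.2)

lemma eventually_le_optTime
    (hΛ : IsLogLR (globalFiltration S) (jointLaw P₀ P₁ A) (jointLaw P₀ P₁ B) Λ)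
    (hgrowth : GrowthLE (jointLaw P₀ P₁ A) Λ R) (hR : 0 < R) (hA : A ∈ Pr) (hB : B ∈ Pr)
    (hiA : i ∈ A) (hiB : i ∉ B) {r : ℝ} (hr : r < 1 / R) :
    ∀ᶠ p : ℝ × ℝ in 𝓝[>] 0 ×ˢ 𝓝[>] 0,
      ENNReal.ofReal (r * -Real.log p.1) ≤ optTime P₀ P₁ Pr i A p.1 p.2 := by
  filter_upwards [eventually_le_expTime hΛ hgrowth hR hA hB hiA hiB hr] with p hp
  exact le_iInf₂ fun χ hχ => hp χ hχ (χ.isDecision i)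

variable {I J : Fin K → ℝ}

lemma eventually_le_optTimeDec (h : StreamAssumptions (P₀ i) (P₁ i) (I i) (J i)) (hA : A ∈ Pr)
    (hB : B ∈ Pr) (hiA : i ∈ A) (hiB : i ∉ B) {r : ℝ} (hr : r < 1 / I i) :
    ∀ᶠ p : ℝ × ℝ in 𝓝[>] 0 ×ˢ 𝓝[>] 0,
      ENNReal.ofReal (r * -Real.log p.1) ≤ optTimeDec P₀ P₁ Pr i A p.1 p.2 := by
  filter_upwards [eventually_le_expTime (isLogLR_localFiltration h hiA hiB)
    (growthLE_streamLLR h hiA) h.I_pos hA hB hiA hiB hr] with p hp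
  exact le_iInf₂ fun χ hχ => hp χ hχ.2 (hχ.1 i)

lemma eventually_gapProcedure_mem_controlled
    (h : ∀ k, StreamAssumptions (P₀ k) (P₁ k) (I k) (J k)) (hK : 0 < K)
    (hA : ∀ B ∈ Pr, B ⊆ A → A ⊆ B) :
    ∀ᶠ p : ℝ × ℝ in 𝓝[>] 0 ×ˢ 𝓝[>] 0,
      gapProcedure P₀ P₁ A (gapThreshold K p.1) (gapThreshold K p.2) ∈
        controlled P₀ P₁ Pr p.1 p.2 := by
  filter_upwards [tendsto_fst.eventually eventually_mem_nhdsWithin,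
    tendsto_snd.eventually eventually_mem_nhdsWithin] with p hα hβ
  exact gapProcedure_mem_controlled h hK hA hα hβ

lemma exists_optTimeDec_le (h : ∀ k, StreamAssumptions (P₀ k) (P₁ k) (I k) (J k)) (hi : i ∈ A)
    {r : ℝ} (hr : 0 < r) (hrI : r < I i) :
    ∃ (c : ℝ) (C : ℝ≥0∞), C < ∞ ∧ ∀ᶠ p : ℝ × ℝ in 𝓝[>] 0 ×ˢ 𝓝[>] 0,
      optTimeDec P₀ P₁ Pr i A p.1 p.2 ≤ ENNReal.ofReal ((-Real.log p.1 + c) / r) + C := by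
  obtain ⟨C, hC, hle⟩ := (completeGrowthGE_streamLLR (h i) hi).exists_lintegral_le
    (measurable_streamLLR P₀ P₁ i) hr hrI
  refine ⟨Real.log (2 * K), C, hC, ?_⟩
  filter_upwards [eventually_gapProcedure_mem_controlled (A := ∅) h i.pos
    fun B _ _ => Finset.empty_subset B] with p hp
  exact (iInf₂_le _ ⟨decentralized_gapProcedure_empty _ _ _ _, hp⟩).trans
    (hle (gapThreshold K p.1) ((gapProcedure P₀ P₁ ∅ (gapThreshold K p.1) _).T i) fun n hn ω hω =>
      gapProcedure_T_le _ _ _ _ _ hn (Or.inl (Or.inl hω)))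

lemma completeGrowthGE_inf'_streamLLR_sub
    (h : ∀ k, StreamAssumptions (P₀ k) (P₁ k) (I k) (J k)) (hA : Aᶜ.Nonempty) (hi : i ∈ A)
    (hj : ∀ k ∉ A, J j ≤ J k) :
    CompleteGrowthGE (jointLaw P₀ P₁ A)
      (fun n ω => Aᶜ.inf' hA fun k => (streamLLR P₀ P₁ i - streamLLR P₀ P₁ k) n ω)
      (I i + J j) := by
  refine .inf' hA fun k hk => ?_
  have hk' : k ∉ A := Finset.mem_compl.1 hk
  rw [sub_eq_add_neg]
  exact ((completeGrowthGE_streamLLR (h i) hi).add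
    (completeGrowthGE_neg_streamLLR (h k) hk')).mono (add_le_add_right (hj k hk') _)

lemma exists_optTime_le (h : ∀ k, StreamAssumptions (P₀ k) (P₁ k) (I k) (J k))
    (hA : ∀ B ∈ Pr, B ⊆ A → A ⊆ B) (hi : i ∈ A) (hjA : j ∉ A) (hj : ∀ k ∉ A, J j ≤ J k)
    {r : ℝ} (hr : 0 < r) (hrIJ : r < I i + J j) :
    ∃ (c : ℝ) (C : ℝ≥0∞), C < ∞ ∧ ∀ᶠ p : ℝ × ℝ in 𝓝[>] 0 ×ˢ 𝓝[>] 0,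
      optTime P₀ P₁ Pr i A p.1 p.2 ≤ ENNReal.ofReal ((-Real.log p.1 + c) / r) + C := by
  have hne : Aᶜ.Nonempty := ⟨j, Finset.mem_compl.2 hjA⟩
  have hmeas : ∀ n, Measurable fun ω : ∀ k, ℕ → S k =>
      Aᶜ.inf' hne fun k => (streamLLR P₀ P₁ i - streamLLR P₀ P₁ k) n ω := fun n => by
    simpa only [← Finset.inf'_apply] using Finset.inf'_induction hne
      (fun k => (streamLLR P₀ P₁ i - streamLLR P₀ P₁ k) n) (fun _ hf _ hg => hf.inf hg) fun k _ =>
        (measurable_streamLLR P₀ P₁ i n).sub (measurable_streamLLR P₀ P₁ k n)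
  obtain ⟨C, hC, hle⟩ :=
    (completeGrowthGE_inf'_streamLLR_sub h hne hi hj).exists_lintegral_le hmeas hr hrIJ
  refine ⟨Real.log (2 * K), C, hC, ?_⟩
  filter_upwards [eventually_gapProcedure_mem_controlled h i.pos hA] with p hp
  refine (iInf₂_le _ hp).trans
    (hle (gapThreshold K p.1) ((gapProcedure P₀ P₁ A (gapThreshold K p.1) _).T i) fun n hn ω hω =>
      gapProcedure_T_le _ _ _ _ _ hn (Or.inl (Or.inr ⟨hi, fun k hk => ?_⟩)))
  exact hω.trans (Finset.inf'_le _ (Finset.mem_compl.2 hk))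

lemma hasLogSlope_optTimeDec (h : ∀ k, StreamAssumptions (P₀ k) (P₁ k) (I k) (J k)) (hA : A ∈ Pr)
    (hi : i ∈ A) (hB : B ∈ Pr) (hiB : i ∉ B) :
    HasLogSlope (fun p => optTimeDec P₀ P₁ Pr i A p.1 p.2) (ENNReal.ofReal (1 / I i)) :=
  hasLogSlope_of_bounds (h i).I_pos (fun _ => eventually_le_optTimeDec (h i) hA hB hi hiB)
    fun _ => exists_optTimeDec_le h hi

lemma hasLogSlope_optTime_of_erase_mem (h : ∀ k, StreamAssumptions (P₀ k) (P₁ k) (I k) (J k))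
    (hA : A ∈ Pr) (hi : i ∈ A) (herase : A.erase i ∈ Pr) :
    HasLogSlope (fun p => optTime P₀ P₁ Pr i A p.1 p.2) (ENNReal.ofReal (1 / I i)) := by
  have hΛ := isLogLR_insert h (Finset.notMem_erase i A)
  rw [Finset.insert_erase hi] at hΛ
  refine hasLogSlope_of_bounds (h i).I_pos (fun r hr => eventually_le_optTime hΛ
    (growthLE_streamLLR (h i) hi) (h i).I_pos hA herase hi (Finset.notMem_erase i A) hr)
    fun r hr hrI => ?_
  obtain ⟨c, C, hC, hle⟩ := exists_optTimeDec_le h hi hr hrI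
  exact ⟨c, C, hC, hle.mono fun p hp => (optTime_le_optTimeDec _ _).trans hp⟩

lemma hasLogSlope_optTime_of_minimal (h : ∀ k, StreamAssumptions (P₀ k) (P₁ k) (I k) (J k))
    (hA : Minimal (· ∈ Pr) A) (hi : i ∈ A) (hjA : j ∉ A) (hj : ∀ k ∉ A, J j ≤ J k)
    (hexchange : insert j (A.erase i) ∈ Pr) :
    HasLogSlope (fun p => optTime P₀ P₁ Pr i A p.1 p.2) (ENNReal.ofReal (1 / (I i + J j))) := by
  have hij : i ≠ j := fun hij => hjA (hij ▸ hi)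
  have hIJ : 0 < I i + J j := add_pos (h i).I_pos (h j).J_pos
  have hΛ := (isLogLR_insert_erase h hjA hi).symm
  have hgrowth := (growthLE_streamLLR (h i) hi).add (growthLE_neg_streamLLR (h j) hjA)
  rw [neg_sub, sub_eq_add_neg] at hΛ
  exact hasLogSlope_of_bounds hIJ
    (fun _ => eventually_le_optTime hΛ hgrowth hIJ hA.prop hexchange hi (by simp [hij]))
    fun _ => exists_optTime_le h (fun B hB hBA => hA.le_of_le hB hBA) hi hjA hj

end OptimalTimes

section RelativeEfficiency

variable {K : ℕ} {S : Fin K → Type*} [∀ k, MeasurableSpace (S k)]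
    {P₀ P₁ : ∀ k, Measure (ℕ → S k)} [∀ k, IsProbabilityMeasure (P₀ k)]
    [∀ k, IsProbabilityMeasure (P₁ k)] {I J : Fin K → ℝ} {l u : ℕ} {A : Finset (Fin K)} {i : Fin K}

lemma exists_minRate_eq (r : Fin K → ℝ) {B : Finset (Fin K)} (hB : B.Nonempty) :
    ∃ j ∈ B, minRate r B = ENNReal.ofReal (r j) ∧ ∀ k ∈ B, r j ≤ r k := by
  obtain ⟨j, hj, hmin⟩ := B.exists_min_image r hB
  exact ⟨j, hj, le_antisymm (Finset.inf_le hj)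
    (Finset.le_inf fun k hk => ENNReal.ofReal_le_ofReal (hmin k hk)), hmin⟩

lemma minimal_mem_boundedClass (hA : A ∈ boundedClass K l u) (hAl : A.card = l) :
    Minimal (· ∈ boundedClass K l u) A :=
  ⟨hA, fun _ hB hBA => (Finset.eq_of_subset_of_card_le hBA (hAl.trans_le hB.1)).ge⟩

lemma hasAREDec_of_mem_of_card_eq (h : ∀ k, StreamAssumptions (P₀ k) (P₁ k) (I k) (J k))
    (hl : l < K) (hA : A ∈ boundedClass K l u) (hi : i ∈ A) (hAl : A.card = l) :
    HasAREDec P₀ P₁ l u i A (ENNReal.ofReal (I i) / (ENNReal.ofReal (I i) + minRate J Aᶜ)) := by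
  have hne : Aᶜ.Nonempty := Finset.card_pos.1 (by rw [Finset.card_compl, Fintype.card_fin]; omega)
  obtain ⟨j, hjA, hrate, hmin⟩ := exists_minRate_eq J hne
  have hj : ∀ k ∉ A, J j ≤ J k := fun k hk => hmin k (Finset.mem_compl.2 hk)
  rw [Finset.mem_compl] at hjA
  have hj_erase : j ∉ A.erase i := fun hmem => hjA (Finset.mem_of_mem_erase hmem)
  have hcard : (insert j (A.erase i)).card = A.card := by
    rw [Finset.card_insert_of_notMem hj_erase, Finset.card_erase_add_one hi]
  have hexchange : insert j (A.erase i) ∈ boundedClass K l u := ⟨hcard ▸ hA.1, hcard ▸ hA.2⟩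
  have hij : i ∉ insert j (A.erase i) := by simp [show i ≠ j from fun hij => hjA (hij ▸ hi)]
  have hI := (h i).I_pos
  have hJ := (h j).J_pos
  have hIJ : 0 < I i + J j := add_pos hI hJ
  have hratio := (hasLogSlope_optTime_of_minimal h (minimal_mem_boundedClass hA hAl) hi hjA hj
    hexchange).tendsto_div (hasLogSlope_optTimeDec h hA hi hexchange hij)
      (ENNReal.ofReal_pos.2 (one_div_pos.2 hIJ)).ne' ENNReal.ofReal_ne_top
  have hslope : 1 / (I i + J j) / (1 / I i) = I i / (I i + J j) := by field_simp
  rwa [← ENNReal.ofReal_div_of_pos (one_div_pos.2 hI), hslope,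
    ENNReal.ofReal_div_of_pos hIJ, ENNReal.ofReal_add hI.le hJ.le, ← hrate] at hratio

lemma hasAREDec_of_mem_of_card_ne (h : ∀ k, StreamAssumptions (P₀ k) (P₁ k) (I k) (J k))
    (hA : A ∈ boundedClass K l u) (hi : i ∈ A) (hAl : A.card ≠ l) :
    HasAREDec P₀ P₁ l u i A 1 := by
  have herase : A.erase i ∈ boundedClass K l u := by
    refine ⟨?_, (Finset.card_erase_le).trans hA.2⟩
    rw [Finset.card_erase_of_mem hi]
    exact Nat.le_sub_one_of_lt (lt_of_le_of_ne hA.1 hAl.symm)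
  have hI := (ENNReal.ofReal_pos.2 (one_div_pos.2 (h i).I_pos)).ne'
  have hratio := (hasLogSlope_optTime_of_erase_mem h hA hi herase).tendsto_div
    (hasLogSlope_optTimeDec h hA hi herase (Finset.notMem_erase i A)) hI ENNReal.ofReal_ne_top
  rwa [ENNReal.div_self hI ENNReal.ofReal_ne_top] at hratio

theorem hasAREDec_of_mem (h : ∀ k, StreamAssumptions (P₀ k) (P₁ k) (I k) (J k)) (hl : l < K)
    (hA : A ∈ boundedClass K l u) (hi : i ∈ A) :
    HasAREDec P₀ P₁ l u i A
      (if A.card = l then ENNReal.ofReal (I i) / (ENNReal.ofReal (I i) + minRate J Aᶜ) else 1) := by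
  split_ifs with hAl
  · exact hasAREDec_of_mem_of_card_eq h hl hA hi hAl
  · exact hasAREDec_of_mem_of_card_ne h hA hi hAl

end RelativeEfficiency

section Symmetry

variable {K : ℕ} {S : Fin K → Type*} [∀ k, MeasurableSpace (S k)]

lemma IsDecision.not {Ω : Type*} [MeasurableSpace Ω] {F : ℕ → MeasurableSpace Ω}
    {T : Ω → ℕ∞} {D : Ω → Bool} (h : IsDecision F T D) : IsDecision F T fun ω => !D ω where
  one_le := h.one_le
  measurable_D := (measurable_of_countable Bool.not).comp h.measurable_D
  time := h.time
  decision n i := by simpa only [Bool.not_eq_eq_eq_not] using h.decision n !i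

/-- The procedure with the opposite decisions.  It exchanges the roles of signals and noise, hence
of the two familywise error rates. -/
def Procedure.not (χ : Procedure S) : Procedure S where
  T := χ.T
  D k ω := !χ.D k ω
  isDecision k := (χ.isDecision k).not

lemma jointLaw_swap (P₀ P₁ : ∀ k, Measure (ℕ → S k)) (A : Finset (Fin K)) :
    jointLaw P₁ P₀ A = jointLaw P₀ P₁ Aᶜ := by
  refine congrArg Measure.pi (funext fun k => ?_)
  simp only [Finset.mem_compl, ite_not]

variable {P₀ P₁ : ∀ k, Measure (ℕ → S k)} {Pr : Set (Finset (Fin K))} {k : Fin K}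
    {A : Finset (Fin K)} {α β : ℝ}

lemma Procedure.fwe₁_not (χ : Procedure S) : χ.not.fwe₁ P₁ P₀ A = χ.fwe₂ P₀ P₁ Aᶜ := by
  simp [fwe₁, fwe₂, jointLaw_swap P₀ P₁, Procedure.not]

lemma Procedure.fwe₂_not (χ : Procedure S) : χ.not.fwe₂ P₁ P₀ A = χ.fwe₁ P₀ P₁ Aᶜ := by
  simp [fwe₁, fwe₂, jointLaw_swap P₀ P₁, Procedure.not]

lemma Procedure.expTime_not (χ : Procedure S) :
    χ.not.expTime P₁ P₀ k Aᶜ = χ.expTime P₀ P₁ k A := by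
  rw [expTime, expTime, jointLaw_swap, compl_compl]
  rfl

lemma Procedure.not_mem_controlled {χ : Procedure S} (hχ : χ ∈ controlled P₀ P₁ Pr α β) :
    χ.not ∈ controlled P₁ P₀ (compl ⁻¹' Pr) β α := fun A hA => by
  obtain ⟨hT, h₁, h₂⟩ := hχ Aᶜ hA
  rw [jointLaw_swap, fwe₁_not, fwe₂_not]
  exact ⟨hT, h₂, h₁⟩

lemma optTime_swap_le :
    optTime P₁ P₀ (compl ⁻¹' Pr) k Aᶜ β α ≤ optTime P₀ P₁ Pr k A α β :=
  le_iInf₂ fun χ hχ => (iInf₂_le χ.not (Procedure.not_mem_controlled hχ)).trans χ.expTime_not.le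

lemma optTimeDec_swap_le :
    optTimeDec P₁ P₀ (compl ⁻¹' Pr) k Aᶜ β α ≤ optTimeDec P₀ P₁ Pr k A α β :=
  le_iInf₂ fun χ hχ => (iInf₂_le χ.not
    ⟨fun k => (hχ.1 k).not, Procedure.not_mem_controlled hχ.2⟩).trans χ.expTime_not.le

lemma optTime_swap : optTime P₁ P₀ (compl ⁻¹' Pr) k Aᶜ β α = optTime P₀ P₁ Pr k A α β :=
  optTime_swap_le.antisymm <| by
    have hle := optTime_swap_le (P₀ := P₁) (P₁ := P₀) (Pr := compl ⁻¹' Pr) (k := k) (A := Aᶜ)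
      (α := β) (β := α)
    rwa [← Set.preimage_comp, compl_involutive.comp_self, Set.preimage_id, compl_compl] at hle

lemma optTimeDec_swap :
    optTimeDec P₁ P₀ (compl ⁻¹' Pr) k Aᶜ β α = optTimeDec P₀ P₁ Pr k A α β :=
  optTimeDec_swap_le.antisymm <| by
    have hle := optTimeDec_swap_le (P₀ := P₁) (P₁ := P₀) (Pr := compl ⁻¹' Pr) (k := k) (A := Aᶜ)
      (α := β) (β := α)
    rwa [← Set.preimage_comp, compl_involutive.comp_self, Set.preimage_id, compl_compl] at hle

variable {l u : ℕ}

lemma card_compl_fin (A : Finset (Fin K)) : Aᶜ.card = K - A.card := by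
  rw [Finset.card_compl, Fintype.card_fin]

lemma compl_preimage_boundedClass (hlu : l ≤ u) (huK : u ≤ K) :
    compl ⁻¹' boundedClass K l u = boundedClass K (K - u) (K - l) := by
  ext A
  have hAK := card_finset_fin_le A
  change (l ≤ Aᶜ.card ∧ Aᶜ.card ≤ u) ↔ (K - u ≤ A.card ∧ A.card ≤ K - l)
  rw [card_compl_fin]
  omega

lemma HasAREDec.swap (hlu : l ≤ u) (huK : u ≤ K) {r : ℝ≥0∞}
    (h : HasAREDec P₁ P₀ (K - u) (K - l) k Aᶜ r) : HasAREDec P₀ P₁ l u k A r := by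
  refine (h.comp (tendsto_snd.prodMk tendsto_fst :
    Tendsto (fun p : ℝ × ℝ => (p.2, p.1)) (𝓝[>] 0 ×ˢ 𝓝[>] 0) (𝓝[>] 0 ×ˢ 𝓝[>] 0))).congr fun p => ?_
  simp only [Function.comp, ← compl_preimage_boundedClass hlu huK, optTime_swap, optTimeDec_swap]

theorem hasAREDec_of_notMem [∀ k, IsProbabilityMeasure (P₀ k)] [∀ k, IsProbabilityMeasure (P₁ k)]
    {I J : Fin K → ℝ} (h : ∀ k, StreamAssumptions (P₀ k) (P₁ k) (I k) (J k)) (hlu : l ≤ u)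
    (huK : u ≤ K) (hu : 0 < u) (hA : A ∈ boundedClass K l u) (hk : k ∉ A) :
    HasAREDec P₀ P₁ l u k A
      (if A.card = u then ENNReal.ofReal (J k) / (ENNReal.ofReal (J k) + minRate I A) else 1) := by
  have hA' : Aᶜ ∈ boundedClass K (K - u) (K - l) := by
    rwa [← compl_preimage_boundedClass hlu huK, Set.mem_preimage, compl_compl]
  have hcard : Aᶜ.card = K - u ↔ A.card = u := by
    have hAu := hA.2
    rw [card_compl_fin]
    omega
  have hswap := hasAREDec_of_mem (fun k => (h k).swap) (by omega) hA' (Finset.mem_compl.2 hk)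
  simp only [hcard, compl_compl] at hswap
  exact hswap.swap hlu huK

end Symmetry

end SeqTest

open SeqTest in
theorem corollary4p1 {K : ℕ} {S : Fin K → Type*} [∀ k, MeasurableSpace (S k)]
    (P₀ P₁ : ∀ k, Measure (ℕ → S k))
    [∀ k, IsProbabilityMeasure (P₀ k)] [∀ k, IsProbabilityMeasure (P₁ k)]
    (I J : Fin K → ℝ) (hP : ∀ k, StreamAssumptions (P₀ k) (P₁ k) (I k) (J k))
    (l u : ℕ) (hlu : l ≤ u) (huK : u ≤ K) (hu : 0 < u) (hl : l < K)
    (A : Finset (Fin K)) (hA : A ∈ boundedClass K l u) :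
    (∀ i ∈ A, HasAREDec P₀ P₁ l u i A
      (if A.card = l then ENNReal.ofReal (I i) / (ENNReal.ofReal (I i) + minRate J Aᶜ) else 1)) ∧
    (∀ j ∉ A, HasAREDec P₀ P₁ l u j A
      (if A.card = u then ENNReal.ofReal (J j) / (ENNReal.ofReal (J j) + minRate I A) else 1)) ∧
    (l = 0 → ∀ i ∈ A, HasAREDec P₀ P₁ l u i A 1) ∧
    (u = K → ∀ j ∉ A, HasAREDec P₀ P₁ l u j A 1) := by
  have hmem := fun i => hasAREDec_of_mem (i := i) hP hl hA
  have hnotMem := fun j => hasAREDec_of_notMem (k := j) hP hlu huK hu hA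
  refine ⟨hmem, hnotMem, fun hl0 i hi => ?_, fun huK' j hj => ?_⟩
  · have hAl : A.card ≠ l := hl0 ▸ (Finset.card_pos.2 ⟨i, hi⟩).ne'
    simpa only [if_neg hAl] using hmem i hi
  · have hAu : A.card ≠ u := fun hcard =>
      hj (Finset.eq_univ_of_card A (by rw [hcard, huK', Fintype.card_fin]) ▸ Finset.mem_univ j)
    simpa only [if_neg hAu] using hnotMem j hj
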